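/- Let $\mathsf{P}_0$ be the theory, in classical logic over all finite types $0$, $\sigma\to\tau$, $\sigma^*$ (finite sequences of objects of type $\sigma$) and with a standardness predicate $\mathrm{st}$ in every type, given by $\mathsf{P}_0 := \mathsf{E\text{-}PRA}^{\omega*}+\mathcal{T}^*_{\mathrm{st}}+\mathsf{HAC}_{\mathrm{int}}+\mathsf{I}+\mathsf{QF\text{-}AC}^{1,0}$. Here $\mathsf{E\text{-}PRA}^{\omega*}$ is Kohlenbach's primitive recursive arithmetic in all finite types (zero, successor, the combinators, the recursor $R_0$ with values of type $0$, quantifier-free induction, and the axiom of extensionality, equality in higher types being pointwise), extended by types for finite sequences. $\mathcal{T}^*_{\mathrm{st}}$ consists of the axioms $\mathrm{st}(x)\wedge x=y\to\mathrm{st}(y)$, $\mathrm{st}(t)$ for closed terms $t$, and $\mathrm{st}(f)\wedge\mathrm{st}(x)\to\mathrm{st}(f(x))$. With $\varphi$ ranging over the internal formulas (those without $\mathrm{st}$) and $\varphi_0$ over the quantifier-free internal formulas, parameters being allowed in both, the remaining schemas are * $\mathsf{HAC}_{\mathrm{int}}$: $(\forall^{\mathrm{st}}x^\rho)(\exists^{\mathrm{st}}y^\tau)\varphi(x,y)\to(\exists^{\mathrm{st}}F^{\rho\to\tau^*})(\forall^{\mathrm{st}}x^\rho)(\exists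 y\in F(x))\varphi(x,y)$; * $\mathsf{I}$: $(\forall^{\mathrm{st}}x^{\sigma^*})(\exists y^\tau)(\forall z\in x)\varphi(z,y)\to(\exists y^\tau)(\forall^{\mathrm{st}}x^\sigma)\varphi(x,y)$; * $\mathsf{QF\text{-}AC}^{1,0}$: $(\forall f^1)(\exists n^0)\varphi_0(f,n)\to(\exists F^{1\to 0})(\forall f^1)\varphi_0(f,F(f))$. Write $1$ for the type $0\to 0$, and $f\le_1 1$ for $(\forall n^0)(f(n)\le 1)$. A binary tree $T$ is a set (given by its characteristic function) of finite sequences of zeros and ones that is closed under initial segments; $\overline{\beta}m$ is the initial segment of length $m$ of the sequence $\beta$; and $\nu(T)>_{\mathbb R}0$ means $(\exists k>0)(\forall n)\big(\#\{\sigma\in T:|\sigma|=n\}/2^n\ge 1/k\big)$. In the following principles $T$ ranges over all (not only the standard) binary trees: * $\mathsf{WWKL}$: $(\forall T)\big[\nu(T)>_{\mathbb R}0\to(\exists\beta\le_1 1)(\forall m)(\overline{\beta}m\in T)\big]$; * $\mathsf{STP}$: $(\forall\alpha\le_1 1)(\exists^{\mathrm{st}}\beta\le_1 1)(\forall^{\mathrm{st}}n)(\alpha(n)=\beta(n))$;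 * $\mathsf{LMP}^+$: $(\forall T)\big[\nu(T)>_{\mathbb R}0\to(\exists^{\mathrm{st}}\beta\le_1 1)(\forall^{\mathrm{st}}m)(\overline{\beta}m\in T)\big]$; * $\mathsf{STP}^-$: $(\forall T)\big[(\forall n)(\exists\sigma\in T)(|\sigma|=n)\to(\exists^{\mathrm{st}}\beta\le_1 1)(\forall^{\mathrm{st}}m)(\overline{\beta}m\in T)\big]$. **Theorem.** The theory $\mathsf{P}_0+\mathsf{WWKL}$ proves $\mathsf{STP}\leftrightarrow\mathsf{LMP}^+$, $\mathsf{LMP}^+\leftrightarrow\mathsf{STP}^-$ and $\mathsf{STP}\leftrightarrow\mathsf{STP}^-$. -/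

import Mathlib

/-! Formal systems of higher-order arithmetic with a standardness predicate: finite types, terms,
formulas, derivability, the base theory `Pzero`, and the principles under comparison. -/

namespace NSA

/-! ### Types, terms, formulas

Variables are indexed by a type and a natural number. The quantifier `all σ` binds the variable
`var σ 0` and shifts the indices of the other variables of type `σ` by one (de Bruijn indices,
counted separately for each type: variables of types other than `σ` keep their index). -/

/-- The finite types: `0`, `σ → τ`, and the type `σ*` of finite sequences of objects of type `σ`. -/
inductive Ty : Type
  | nat : Ty
  | arrow : Ty → Ty → Ty
  | seq : Ty → Ty
  deriving DecidableEq

infixr:60 " ⇒ " => Ty.arrow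

/-- The type `0`. -/
abbrev N : Ty := Ty.nat

/-- The type `1 = 0 → 0`. -/
abbrev One : Ty := N ⇒ N

/-- The constants: zero, successor, the combinators `Π` and `Σ`, the primitive recursor `R₀` with
values of type `0`, and, for every type `σ`, the operations on finite sequences
`mk n f = ⟨f 0, …, f (n - 1)⟩`, `len s = |s|` and `proj s i = s_i`. -/
inductive Const : Ty → Type
  | zero : Const N
  | succ : Const (N ⇒ N)
  | k (ρ τ : Ty) : Const (ρ ⇒ τ ⇒ ρ)
  | s (δ ρ τ : Ty) : Const ((δ ⇒ ρ ⇒ τ) ⇒ (δ ⇒ ρ) ⇒ δ ⇒ τ)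
  | recursor : Const (N ⇒ N ⇒ (N ⇒ N ⇒ N) ⇒ N)
  | mk (σ : Ty) : Const (N ⇒ (N ⇒ σ) ⇒ Ty.seq σ)
  | len (σ : Ty) : Const (Ty.seq σ ⇒ N)
  | proj (σ : Ty) : Const (Ty.seq σ ⇒ N ⇒ σ)

/-- Terms of a given type. -/
inductive Tm : Ty → Type
  | var (σ : Ty) (n : ℕ) : Tm σ
  | const {σ : Ty} (c : Const σ) : Tm σ
  | app {σ τ : Ty} (f : Tm (σ ⇒ τ)) (a : Tm σ) : Tm τ

infixl:100 " ⬝ " => Tm.app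

/-- Formulas of many-sorted first-order logic over the atoms `s =₀ t` and `st(t)`. -/
inductive Fm : Type
  | eq (s t : Tm N) : Fm
  | st {σ : Ty} (t : Tm σ) : Fm
  | bot : Fm
  | imp (φ ψ : Fm) : Fm
  | all (σ : Ty) (φ : Fm) : Fm

infixr:40 " ⟶ᶠ " => Fm.imp

/-- Negation. -/
def Fm.neg (φ : Fm) : Fm := φ ⟶ᶠ Fm.bot

/-- Conjunction (classically defined). -/
def Fm.and (φ ψ : Fm) : Fm := Fm.neg (φ ⟶ᶠ Fm.neg ψ)

infixr:50 " ⋏ " => Fm.and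

/-- Equivalence. -/
def Fm.iff (φ ψ : Fm) : Fm := (φ ⟶ᶠ ψ) ⋏ (ψ ⟶ᶠ φ)

/-- Existential quantifier (classically defined); it binds `var σ 0`. -/
def Fm.ex (σ : Ty) (φ : Fm) : Fm := Fm.neg (Fm.all σ (Fm.neg φ))

/-- The quantifier `(∀ˢᵗ x^σ)`. -/
def Fm.allSt (σ : Ty) (φ : Fm) : Fm := Fm.all σ (Fm.st (Tm.var σ 0) ⟶ᶠ φ)

/-- The quantifier `(∃ˢᵗ x^σ)`. -/
def Fm.exSt (σ : Ty) (φ : Fm) : Fm := Fm.ex σ (Fm.st (Tm.var σ 0) ⋏ φ)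

/-- A formula is internal if `st` does not occur in it. -/
def Fm.Internal : Fm → Prop
  | .eq _ _ => True
  | .st _ => False
  | .bot => True
  | .imp φ ψ => φ.Internal ∧ ψ.Internal
  | .all _ φ => φ.Internal

/-- A formula is quantifier-free if it is internal and contains no quantifier. -/
def Fm.QuantifierFree : Fm → Prop
  | .eq _ _ => True
  | .st _ => False
  | .bot => True
  | .imp φ ψ => φ.QuantifierFree ∧ ψ.QuantifierFree
  | .all _ _ => False

/-- A term is closed if it contains no variable. -/
def Tm.Closed : {σ : Ty} → Tm σ → Prop
  | _, .var _ _ => False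
  | _, .const _ => True
  | _, .app f a => f.Closed ∧ a.Closed

/-! ### Renaming and substitution -/

/-- A renaming of variables. -/
abbrev Ren : Type := Ty → ℕ → ℕ

/-- Make room for a new variable `var σ 0`. -/
def Ren.shift (σ : Ty) : Ren := fun τ n => if τ = σ then n + 1 else n

/-- Push a renaming under a binder of type `σ`. -/
def Ren.up (σ : Ty) (r : Ren) : Ren := fun τ n =>
  if τ = σ then (match n with
    | 0 => 0
    | m + 1 => r τ m + 1)
  else r τ n

/-- Apply a renaming to a term. -/
def Tm.ren : {σ : Ty} → Ren → Tm σ → Tm σ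
  | _, r, .var σ n => .var σ (r σ n)
  | _, _, .const c => .const c
  | _, r, .app f a => .app (f.ren r) (a.ren r)

/-- Weakening of a term by a new variable `var σ 0`. -/
def Tm.wk (σ : Ty) {τ : Ty} (t : Tm τ) : Tm τ := t.ren (Ren.shift σ)

/-- Apply a renaming to a formula. -/
def Fm.ren : Ren → Fm → Fm
  | r, .eq s t => .eq (s.ren r) (t.ren r)
  | r, .st t => .st (t.ren r)
  | _, .bot => .bot
  | r, .imp φ ψ => .imp (φ.ren r) (ψ.ren r)
  | r, .all σ φ => .all σ (φ.ren (Ren.up σ r))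

/-- Weakening of a formula by a new variable `var σ 0`. -/
def Fm.wk (σ : Ty) (φ : Fm) : Fm := φ.ren (Ren.shift σ)

/-- A substitution of terms for variables. -/
abbrev Sub : Type := (σ : Ty) → ℕ → Tm σ

/-- Push a substitution under a binder of type `σ`. -/
def Sub.up (σ : Ty) (s : Sub) : Sub := fun τ n =>
  if τ = σ then (match n with
    | 0 => Tm.var τ 0
    | m + 1 => (s τ m).wk σ)
  else (s τ n).wk σ

/-- The substitution that replaces `var σ 0` by `t` and removes this variable. -/
def Sub.single {σ : Ty} (t : Tm σ) : Sub := fun τ n =>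
  if h : σ = τ then (match n with
    | 0 => h ▸ t
    | m + 1 => Tm.var τ m)
  else Tm.var τ n

/-- Apply a substitution to a term. -/
def Tm.sub : {σ : Ty} → Sub → Tm σ → Tm σ
  | _, s, .var σ n => s σ n
  | _, _, .const c => .const c
  | _, s, .app f a => .app (f.sub s) (a.sub s)

/-- Apply a substitution to a formula. -/
def Fm.sub : Sub → Fm → Fm
  | s, .eq a b => .eq (a.sub s) (b.sub s)
  | s, .st t => .st (t.sub s)
  | _, .bot => .bot
  | s, .imp φ ψ => .imp (φ.sub s) (ψ.sub s)
  | s, .all σ φ => .all σ (φ.sub (Sub.up σ s))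

/-- The instance `φ(t)` of a formula `φ(x)`, where `x` is `var σ 0`. -/
def Fm.inst {σ : Ty} (φ : Fm) (t : Tm σ) : Fm := φ.sub (Sub.single t)

/-! ### Derivability -/

/-- Natural deduction for classical many-sorted first-order logic: `Prf T Γ φ` says that `φ` is
derivable from the axioms `T` and the open assumptions `Γ`. The free variables of axioms are read
as universally quantified, those of assumptions are not. -/
inductive Prf (T : Set Fm) : List Fm → Fm → Prop
  | ax {Γ : List Fm} {φ : Fm} : φ ∈ T → Prf T Γ φ
  | hyp {Γ : List Fm} {φ : Fm} : φ ∈ Γ → Prf T Γ φ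
  | impI {Γ : List Fm} {φ ψ : Fm} : Prf T (φ :: Γ) ψ → Prf T Γ (φ ⟶ᶠ ψ)
  | impE {Γ : List Fm} {φ ψ : Fm} : Prf T Γ (φ ⟶ᶠ ψ) → Prf T Γ φ → Prf T Γ ψ
  | raa {Γ : List Fm} {φ : Fm} : Prf T (Fm.neg φ :: Γ) Fm.bot → Prf T Γ φ
  | allI {Γ : List Fm} {σ : Ty} {φ : Fm} :
      Prf T (Γ.map (Fm.wk σ)) φ → Prf T Γ (Fm.all σ φ)
  | allE {Γ : List Fm} {σ : Ty} {φ : Fm} (t : Tm σ) :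
      Prf T Γ (Fm.all σ φ) → Prf T Γ (φ.inst t)

/-- `φ` is provable in the theory with axioms `T`. -/
def Provable (T : Set Fm) (φ : Fm) : Prop := Prf T [] φ

/-! ### Abstraction and primitive recursive terms -/

/-- Bracket abstraction `λ x^σ. t`, where `x` is `var σ 0`, by means of the combinators. -/
def Tm.lam (σ : Ty) : {τ : Ty} → Tm τ → Tm (σ ⇒ τ)
  | _, .var τ n =>
      if h : σ = τ then (match n with
        | 0 => h ▸ (.const (.s σ (σ ⇒ σ) σ) ⬝ .const (.k σ (σ ⇒ σ)) ⬝ .const (.k σ σ))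
        | m + 1 => .const (.k τ σ) ⬝ .var τ m)
      else .const (.k τ σ) ⬝ .var τ n
  | τ, .const c => .const (.k τ σ) ⬝ .const c
  | τ, .app (σ := ρ) f a => .const (.s σ ρ τ) ⬝ Tm.lam σ f ⬝ Tm.lam σ a

/-- The term `0`. -/
def zeroN : Tm N := .const .zero

/-- The term `S t`. -/
def succT (t : Tm N) : Tm N := .const .succ ⬝ t

/-- `R₀ n a (λ r i. b)`, where in `b` the variable `r` is `var N 1` and `i` is `var N 0`: the value
at `n` of the function `h` with `h 0 = a` and `h (i + 1) = b (h i) i`. -/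
def recN (n a b : Tm N) : Tm N := .const .recursor ⬝ n ⬝ a ⬝ Tm.lam N (Tm.lam N b)

/-- Predecessor. -/
def predT (t : Tm N) : Tm N := recN t zeroN (.var N 0)

/-- Addition. -/
def addT (s t : Tm N) : Tm N := recN t s (succT (.var N 1))

/-- Truncated subtraction. -/
def tsubT (s t : Tm N) : Tm N := recN t s (predT (.var N 1))

/-- Multiplication. -/
def mulT (s t : Tm N) : Tm N := recN t zeroN (addT (.var N 1) ((s.wk N).wk N))

/-- The power `2 ^ t`. -/
def pow2T (t : Tm N) : Tm N := recN t (succT zeroN) (addT (.var N 1) (.var N 1))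

/-- The remainder of `t` modulo `2`. -/
def parityT (t : Tm N) : Tm N := recN t zeroN (tsubT (succT zeroN) (.var N 1))

/-- The integer part of `t / 2`. -/
def halfT (t : Tm N) : Tm N := recN t zeroN (addT (.var N 1) (parityT (.var N 0)))

/-- The `i`-th binary digit of `j` (the digit of `2 ^ i`). -/
def bitT (i j : Tm N) : Tm N := parityT (recN i j (halfT (.var N 1)))

/-- `⟨f 0, …, f (n - 1)⟩`. For `f` of type `1` this is the initial segment of `f` of length `n`. -/
def mkT {σ : Ty} (n : Tm N) (f : Tm (N ⇒ σ)) : Tm (Ty.seq σ) := .const (.mk σ) ⬝ n ⬝ f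

/-- The length of a finite sequence. -/
def lenT {σ : Ty} (s : Tm (Ty.seq σ)) : Tm N := .const (.len σ) ⬝ s

/-- The `i`-th entry of a finite sequence. -/
def projT {σ : Ty} (s : Tm (Ty.seq σ)) (i : Tm N) : Tm σ := .const (.proj σ) ⬝ s ⬝ i

/-- The zero object of each type; for `σ*` it is the empty sequence. -/
def zeroT : (σ : Ty) → Tm σ
  | .nat => zeroN
  | .arrow σ τ => .const (.k τ σ) ⬝ zeroT τ
  | .seq σ => mkT zeroN (.const (.k σ N) ⬝ zeroT σ)

/-! ### Order, equality in all types, bounded quantifiers -/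

/-- `s ≤ t`, for numbers. -/
def leF (s t : Tm N) : Fm := .eq (tsubT s t) zeroN

/-- `s < t`, for numbers. -/
def ltF (s t : Tm N) : Fm := leF (succT s) t

/-- The quantifier `(∀ i < t)`; it binds `var N 0` in `φ` (but not in `t`). -/
def allLt (t : Tm N) (φ : Fm) : Fm := .all N (ltF (.var N 0) (t.wk N) ⟶ᶠ φ)

/-- The quantifier `(∃ i < t)`; it binds `var N 0` in `φ` (but not in `t`). -/
def exLt (t : Tm N) (φ : Fm) : Fm := .ex N (ltF (.var N 0) (t.wk N) ⋏ φ)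

/-- Equality in type `σ`: pointwise for functionals, and entry by entry for sequences of the same
length. -/
def eqT : (σ : Ty) → Tm σ → Tm σ → Fm
  | .nat, s, t => .eq s t
  | .arrow σ τ, s, t => .all σ (eqT τ (s.wk σ ⬝ .var σ 0) (t.wk σ ⬝ .var σ 0))
  | .seq σ, s, t => .eq (lenT s) (lenT t) ⋏
      allLt (lenT s) (eqT σ (projT (s.wk N) (.var N 0)) (projT (t.wk N) (.var N 0)))

/-- The quantifier `(∀ z ∈ w)` over the entries of a finite sequence `w`, that is, `φ(w_i)` for all
`i < |w|`; here `z` is `var σ 0` in `φ`. -/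
def allMem {σ : Ty} (w : Tm (Ty.seq σ)) (φ : Fm) : Fm :=
  allLt (lenT w) ((φ.ren (Ren.up σ (Ren.shift N))).inst (projT (w.wk N) (.var N 0)))

/-- The quantifier `(∃ z ∈ w)` over the entries of a finite sequence `w`, that is, `φ(w_i)` for some
`i < |w|`; here `z` is `var σ 0` in `φ`. -/
def exMem {σ : Ty} (w : Tm (Ty.seq σ)) (φ : Fm) : Fm :=
  exLt (lenT w) ((φ.ren (Ren.up σ (Ren.shift N))).inst (projT (w.wk N) (.var N 0)))

/-! ### The base theory -/

/-- Axioms of `E-PRA^ω*`: primitive recursive arithmetic in all finite types with quantifier-free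
induction, recursion for values of type `0` only, and the axiom of extensionality, together with
types for finite sequences. -/
inductive EPRA : Fm → Prop
  | eq_refl : EPRA (.eq (.var N 0) (.var N 0))
  | eq_symm : EPRA (.eq (.var N 0) (.var N 1) ⟶ᶠ .eq (.var N 1) (.var N 0))
  | eq_trans : EPRA (.eq (.var N 0) (.var N 1) ⟶ᶠ .eq (.var N 1) (.var N 2) ⟶ᶠ
      .eq (.var N 0) (.var N 2))
  | succ_ne_zero : EPRA (Fm.neg (.eq (succT (.var N 0)) zeroN))
  | succ_inj : EPRA (.eq (succT (.var N 0)) (succT (.var N 1)) ⟶ᶠ .eq (.var N 0) (.var N 1))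
  | k (ρ τ : Ty) : EPRA (eqT ρ (.const (.k ρ τ) ⬝ .var ρ 0 ⬝ .var τ 1) (.var ρ 0))
  | s (δ ρ τ : Ty) : EPRA (eqT τ
      (.const (.s δ ρ τ) ⬝ .var (δ ⇒ ρ ⇒ τ) 0 ⬝ .var (δ ⇒ ρ) 1 ⬝ .var δ 2)
      (.var (δ ⇒ ρ ⇒ τ) 0 ⬝ .var δ 2 ⬝ (.var (δ ⇒ ρ) 1 ⬝ .var δ 2)))
  | rec_zero : EPRA (.eq
      (.const .recursor ⬝ zeroN ⬝ .var N 0 ⬝ .var (N ⇒ N ⇒ N) 0) (.var N 0))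
  | rec_succ : EPRA (.eq
      (.const .recursor ⬝ succT (.var N 1) ⬝ .var N 0 ⬝ .var (N ⇒ N ⇒ N) 0)
      (.var (N ⇒ N ⇒ N) 0 ⬝
        (.const .recursor ⬝ .var N 1 ⬝ .var N 0 ⬝ .var (N ⇒ N ⇒ N) 0) ⬝ .var N 1))
  | len_mk (σ : Ty) : EPRA (.eq (lenT (mkT (.var N 0) (.var (N ⇒ σ) 0))) (.var N 0))
  | proj_mk (σ : Ty) : EPRA (ltF (.var N 1) (.var N 0) ⟶ᶠ
      eqT σ (projT (mkT (.var N 0) (.var (N ⇒ σ) 0)) (.var N 1)) (.var (N ⇒ σ) 0 ⬝ .var N 1))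
  | proj_ge (σ : Ty) : EPRA (leF (lenT (.var (Ty.seq σ) 0)) (.var N 0) ⟶ᶠ
      eqT σ (projT (.var (Ty.seq σ) 0) (.var N 0)) (zeroT σ))
  | ext (ρ τ : Ty) : EPRA (eqT ρ (.var ρ 0) (.var ρ 1) ⟶ᶠ
      eqT τ (.var (ρ ⇒ τ) 2 ⬝ .var ρ 0) (.var (ρ ⇒ τ) 2 ⬝ .var ρ 1))
  | qf_ind (φ : Fm) (hφ : φ.QuantifierFree) : EPRA
      (φ.inst zeroN ⟶ᶠ
        .all N (φ ⟶ᶠ (φ.ren (Ren.up N (Ren.shift N))).inst (succT (.var N 0))) ⟶ᶠ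
        .all N φ)

/-- The basic axioms for the standardness predicate. -/
inductive StAx : Fm → Prop
  | eq (σ : Ty) : StAx (Fm.st (.var σ 0) ⟶ᶠ eqT σ (.var σ 0) (.var σ 1) ⟶ᶠ Fm.st (.var σ 1))
  | closed (σ : Ty) (t : Tm σ) (ht : t.Closed) : StAx (Fm.st t)
  | app (σ τ : Ty) : StAx (Fm.st (.var (σ ⇒ τ) 0) ⟶ᶠ Fm.st (.var σ 1) ⟶ᶠ
      Fm.st (.var (σ ⇒ τ) 0 ⬝ .var σ 1))

/-- The Herbrandized axiom of choice for an internal formula `φ(x, y)`: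
`(∀ˢᵗ x^ρ)(∃ˢᵗ y^τ) φ(x, y) → (∃ˢᵗ F^(ρ → τ*))(∀ˢᵗ x^ρ)(∃ y ∈ F x) φ(x, y)`. -/
def HACint (ρ τ : Ty) (φ : Fm) : Fm :=
  Fm.allSt ρ (Fm.exSt τ φ) ⟶ᶠ
    Fm.exSt (ρ ⇒ Ty.seq τ) (Fm.allSt ρ
      (exMem ((Tm.var (ρ ⇒ Ty.seq τ) 0).wk ρ ⬝ .var ρ 0)
        (φ.ren (Ren.up τ (Ren.up ρ (Ren.shift (ρ ⇒ Ty.seq τ)))))))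

/-- Idealisation for an internal formula `φ(x, y)`:
`(∀ˢᵗ x^σ*)(∃ y^τ)(∀ z ∈ x) φ(z, y) → (∃ y^τ)(∀ˢᵗ x^σ) φ(x, y)`. -/
def Idealisation (σ τ : Ty) (φ : Fm) : Fm :=
  Fm.allSt (Ty.seq σ) (Fm.ex τ (allMem ((Tm.var (Ty.seq σ) 0).wk τ)
      (φ.ren (Ren.up σ (Ren.up τ (Ren.shift (Ty.seq σ))))))) ⟶ᶠ
    Fm.ex τ (Fm.allSt σ φ)

/-- `QF-AC^{1,0}` for a quantifier-free formula `φ(f, n)`: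
`(∀ f^1)(∃ n^0) φ(f, n) → (∃ F^(1 → 0))(∀ f^1) φ(f, F f)`. -/
def QFAC (φ : Fm) : Fm :=
  Fm.all One (Fm.ex N φ) ⟶ᶠ
    Fm.ex (One ⇒ N) (Fm.all One
      ((φ.ren (Ren.up N (Ren.up One (Ren.shift (One ⇒ N))))).inst
        ((Tm.var (One ⇒ N) 0).wk One ⬝ .var One 0)))

/-- The base theory: `E-PRA^ω*`, the basic axioms for `st`, the Herbrandized axiom of choice and
idealisation for internal formulas, and `QF-AC^{1,0}`. Schemas may contain arbitrary parameters. -/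
inductive Pzero : Fm → Prop
  | epra (φ : Fm) : EPRA φ → Pzero φ
  | st (φ : Fm) : StAx φ → Pzero φ
  | hac (ρ τ : Ty) (φ : Fm) : φ.Internal → Pzero (HACint ρ τ φ)
  | ideal (σ τ : Ty) (φ : Fm) : φ.Internal → Pzero (Idealisation σ τ φ)
  | qfac (φ : Fm) : φ.QuantifierFree → Pzero (QFAC φ)

/-! ### Binary trees and the principles -/

/-- The type of (characteristic functions of) sets of finite sequences of numbers. -/
abbrev TreeTy : Ty := Ty.seq N ⇒ N

/-- `f ≤₁ 1`. -/
def binary (f : Tm One) : Fm := .all N (leF (f.wk N ⬝ .var N 0) (succT zeroN))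

/-- `s ∈ T`. -/
def memTree (s : Tm (Ty.seq N)) (T : Tm TreeTy) : Fm := .eq (T ⬝ s) (succT zeroN)

/-- `T` is a binary tree: a characteristic function with values `0` and `1` of a set of finite
sequences of zeros and ones that is closed under initial segments. -/
def binTree (T : Tm TreeTy) : Fm :=
  .all (Ty.seq N)
    (leF (T.wk (Ty.seq N) ⬝ .var (Ty.seq N) 0) (succT zeroN) ⋏
    (memTree (.var (Ty.seq N) 0) (T.wk (Ty.seq N)) ⟶ᶠ
      (allLt (lenT (.var (Ty.seq N) 0))
        (leF (projT (.var (Ty.seq N) 0) (.var N 0)) (succT zeroN)) ⋏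
      .all N (leF (.var N 0) (lenT (.var (Ty.seq N) 0)) ⟶ᶠ
        memTree (mkT (.var N 0) (.const (.proj N) ⬝ .var (Ty.seq N) 0))
          ((T.wk (Ty.seq N)).wk N)))))

/-- The binary word of length `n` whose `i`-th entry is the `i`-th binary digit of `j`. For
`j < 2 ^ n` these are all the binary words of length `n`, each one once. -/
def wordT (n j : Tm N) : Tm (Ty.seq N) := mkT n (Tm.lam N (bitT (.var N 0) (j.wk N)))

/-- The number of elements of length `n` of the binary tree `T`. -/
def countT (T : Tm TreeTy) (n : Tm N) : Tm N :=
  recN (pow2T n) zeroN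
    (addT (.var N 1) ((T.wk N).wk N ⬝ wordT ((n.wk N).wk N) (.var N 0)))

/-- `T` has positive measure: there is `k` such that for all `n` the number of elements of `T` of
length `n`, divided by `2 ^ n`, is at least `1 / k`. -/
def posMeasure (T : Tm TreeTy) : Fm :=
  .ex N (.all N (leF (pow2T (.var N 0))
    (mulT (.var N 1) (countT ((T.wk N).wk N) (.var N 0)))))

/-- `T` is infinite: it has elements of every length. -/
def infiniteTree (T : Tm TreeTy) : Fm :=
  .all N (.ex (Ty.seq N) (memTree (.var (Ty.seq N) 0) ((T.wk N).wk (Ty.seq N)) ⋏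
    .eq (lenT (.var (Ty.seq N) 0)) (.var N 0)))

/-- There is a standard binary sequence all of whose standard initial segments are in `T`. -/
def hasStandardPath (T : Tm TreeTy) : Fm :=
  .exSt One (binary (.var One 0) ⋏
    .allSt N (memTree (mkT (.var N 0) (.var One 0)) ((T.wk One).wk N)))

/-- Weak weak König's lemma: every binary tree of positive measure has a path. -/
def WWKL : Fm :=
  .all TreeTy (binTree (.var TreeTy 0) ⟶ᶠ posMeasure (.var TreeTy 0) ⟶ᶠ
    .ex One (binary (.var One 0) ⋏
      .all N (memTree (mkT (.var N 0) (.var One 0)) (.var TreeTy 0))))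

/-- The nonstandard compactness of Cantor space: every binary sequence `α` is infinitely close to
some standard binary sequence `β`, that is, `α n = β n` for all standard `n`. -/
def STP : Fm :=
  .all One (binary (.var One 0) ⟶ᶠ
    .exSt One (binary (.var One 0) ⋏
      .allSt N (.eq (.var One 1 ⬝ .var N 0) (.var One 0 ⬝ .var N 0))))

/-- Every binary tree of positive measure has a standard path, up to standard length. -/
def LMPplus : Fm :=
  .all TreeTy (binTree (.var TreeTy 0) ⟶ᶠ posMeasure (.var TreeTy 0) ⟶ᶠ
    hasStandardPath (.var TreeTy 0))

/-- Every infinite binary tree has a standard path, up to standard length. -/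
def STPminus : Fm :=
  .all TreeTy (binTree (.var TreeTy 0) ⟶ᶠ infiniteTree (.var TreeTy 0) ⟶ᶠ
    hasStandardPath (.var TreeTy 0))

end NSA

/-! Everything passes through `STP`. Assume `STP` and let `α` be a binary sequence through a tree
`T`. A standard `β` that agrees with `α` at the standard arguments has the same initial segments of
standard length, so it is a standard path in the required sense. For a tree of positive measure,
`WWKL` supplies `α`. For an infinite tree, idealisation gives a number `K` above all standard
numbers, and an element of `T` of length `K`, continued by zeros, serves as `α`.

Conversely, given `α`, consider the tree of binary words that agree with `α` below `K`
(`agreeTree`). It is infinite, and its measure is at least `2 ^ (-K)`; this counts as positive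
because the bound `k` in the definition of positive measure may be nonstandard. A standard path
through it, even one followed only to standard lengths, agrees with `α` at every standard argument.
This direction does not involve `WWKL`.

Comparing initial segments of standard length `m` requires all `i < m` to be standard. This is not
among the axioms for `st`; `STP.st_of_lt` extracts it from `STP`.

Derivations are obtained semantically. A Henkin construction proves completeness
(`provable_of_models`), and dividing by extensional equality reduces it to models with true equality
in every type (`provable_of_emodels`), where ordinary mathematical arguments apply. The numbers of
such a model may be nonstandard and satisfy induction only for quantifier-free formulas, so
arithmetic, bounded search and counting are developed from recursor terms, each induction with an
explicit formula. The combinatorial core is the count in `le_count_agreeTree`. -/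

namespace NSA

/-! ### Substitution calculus -/

/-- Extend an assignment of objects to variables by a value for the variable `var σ 0`. -/
def scons {D : Ty → Type} {σ : Ty} (x : D σ) (e : (τ : Ty) → ℕ → D τ) : (τ : Ty) → ℕ → D τ :=
  fun τ n =>
    if h : σ = τ then (match n with
      | 0 => h ▸ x
      | m + 1 => e τ m)
    else e τ n

section scons
variable {D : Ty → Type} {σ τ : Ty} (x : D σ) (e : (τ : Ty) → ℕ → D τ)

@[simp] theorem scons_zero : scons x e σ 0 = x := by simp [scons]

@[simp] theorem scons_succ (n : ℕ) : scons x e σ (n + 1) = e σ n := by simp [scons]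

@[simp] theorem scons_one : scons x e σ 1 = e σ 0 := scons_succ x e 0

@[simp] theorem scons_two : scons x e σ 2 = e σ 1 := scons_succ x e 1

theorem scons_of_ne (h : σ ≠ τ) (n : ℕ) : scons x e τ n = e τ n := by simp [scons, h]

theorem scons_shift (τ : Ty) (n : ℕ) : scons x e τ (Ren.shift σ τ n) = e τ n := by
  by_cases h : τ = σ
  · subst h; simp [Ren.shift]
  · simp [Ren.shift, h, scons_of_ne x e (Ne.symm h)]

theorem scons_up (r : Ren) (τ : Ty) (n : ℕ) :
    scons x e τ (Ren.up σ r τ n) = scons x (fun τ n => e τ (r τ n)) τ n := by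
  by_cases h : τ = σ
  · subst h; cases n <;> simp [Ren.up]
  · simp [Ren.up, h, scons_of_ne x _ (Ne.symm h)]

end scons

theorem Sub.single_eq {σ : Ty} (t : Tm σ) : Sub.single t = scons t Tm.var := rfl

theorem Sub.up_eq (σ : Ty) (s : Sub) :
    Sub.up σ s = scons (Tm.var σ 0) (fun τ n => (s τ n).wk σ) := by
  funext τ n
  by_cases h : τ = σ
  · subst h; cases n <;> simp [Sub.up]
  · simp [Sub.up, h, scons_of_ne _ _ (Ne.symm h)]

/-- Stated for an arbitrary family of maps so that it serves substitution, evaluation of terms and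
the passage to a quotient alike. -/
theorem comp_scons {D D' : Ty → Type} (g : (τ : Ty) → D τ → D' τ) {σ : Ty} (x : D σ)
    (e : (τ : Ty) → ℕ → D τ) (τ : Ty) (n : ℕ) :
    g τ (scons x e τ n) = scons (g σ x) (fun τ n => g τ (e τ n)) τ n := by
  by_cases h : σ = τ
  · subst h; cases n <;> simp
  · simp [scons_of_ne _ _ h]

theorem Tm.sub_scons (s : Sub) {σ : Ty} (x : Tm σ) (e : Sub) (τ : Ty) (n : ℕ) :
    (scons (D := Tm) x e τ n).sub s = scons (D := Tm) (x.sub s) (fun τ n => (e τ n).sub s) τ n :=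
  comp_scons (D := Tm) (D' := Tm) (fun _ t => t.sub s) x e τ n

theorem Tm.sub_ren {σ : Ty} (t : Tm σ) (r : Ren) (s : Sub) :
    (t.ren r).sub s = t.sub (fun τ n => s τ (r τ n)) := by
  induction t <;> simp_all [Tm.ren, Tm.sub]

theorem Tm.ren_sub {σ : Ty} (t : Tm σ) (s : Sub) (r : Ren) :
    (t.sub s).ren r = t.sub (fun τ n => (s τ n).ren r) := by
  induction t <;> simp_all [Tm.ren, Tm.sub]

theorem Tm.sub_sub {σ : Ty} (t : Tm σ) (s s' : Sub) :
    (t.sub s).sub s' = t.sub (fun τ n => (s τ n).sub s') := by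
  induction t <;> simp_all [Tm.sub]

theorem Tm.sub_var {σ : Ty} (t : Tm σ) : t.sub Tm.var = t := by
  induction t <;> simp_all [Tm.sub]

theorem Sub.up_var (σ : Ty) : Sub.up σ Tm.var = Tm.var := by
  funext τ n
  by_cases h : τ = σ
  · subst h; cases n <;> simp [Sub.up, Tm.wk, Tm.ren, Ren.shift]
  · simp [Sub.up, Tm.wk, Tm.ren, Ren.shift, h]

theorem Sub.up_comp_ren (σ : Ty) (s : Sub) (r : Ren) :
    (fun τ n => Sub.up σ s τ (Ren.up σ r τ n)) = Sub.up σ (fun τ n => s τ (r τ n)) := by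
  funext τ n
  simp only [Sub.up_eq, scons_up]

theorem Tm.wk_sub_up {σ τ : Ty} (t : Tm τ) (s : Sub) :
    (t.wk σ).sub (Sub.up σ s) = (t.sub s).wk σ := by
  simp only [Tm.wk, Tm.sub_ren, Tm.ren_sub, Sub.up_eq, scons_shift]

theorem Sub.up_comp_sub (σ : Ty) (s s' : Sub) :
    (fun τ n => (Sub.up σ s τ n).sub (Sub.up σ s')) = Sub.up σ (fun τ n => (s τ n).sub s') := by
  funext τ n
  rw [Sub.up_eq σ s, Tm.sub_scons]
  simp only [Tm.wk_sub_up]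
  rw [Sub.up_eq σ (fun τ n => (s τ n).sub s')]
  simp [Tm.sub, Sub.up]

theorem Fm.sub_ren (φ : Fm) : ∀ (r : Ren) (s : Sub),
    (φ.ren r).sub s = φ.sub (fun τ n => s τ (r τ n)) := by
  induction φ with
  | all σ φ ih => intro r s; simp [Fm.ren, Fm.sub, ih, Sub.up_comp_ren]
  | _ => intros; simp_all [Fm.ren, Fm.sub, Tm.sub_ren]

theorem Fm.sub_sub (φ : Fm) : ∀ s s' : Sub,
    (φ.sub s).sub s' = φ.sub (fun τ n => (s τ n).sub s') := by
  induction φ with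
  | all σ φ ih => intro r s; simp [Fm.sub, ih, Sub.up_comp_sub]
  | _ => intros; simp_all [Fm.sub, Tm.sub_sub]

theorem Fm.sub_var (φ : Fm) : φ.sub Tm.var = φ := by
  induction φ with
  | all σ φ ih => simp [Fm.sub, Sub.up_var, ih]
  | _ => simp_all [Fm.sub, Tm.sub_var]

theorem Fm.wk_eq_sub (σ : Ty) (φ : Fm) :
    φ.wk σ = φ.sub (fun τ n => Tm.var τ (Ren.shift σ τ n)) := by
  rw [← Fm.sub_ren, Fm.sub_var]; rfl

theorem Fm.wk_sub_up (σ : Ty) (φ : Fm) (s : Sub) :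
    (φ.wk σ).sub (Sub.up σ s) = (φ.sub s).wk σ := by
  rw [Fm.wk, Fm.sub_ren, Fm.wk_eq_sub, Fm.sub_sub]
  congr 1; funext τ n
  rw [Sub.up_eq, scons_shift, Tm.wk, ← Tm.sub_var ((s τ n).ren _), Tm.sub_ren]

/-- The instance cancels the weakening introduced under the binder. This identity matches the
quantifier rules with the satisfaction clause for `all`, both in `Prf.sub_of_all` and in the term
model. -/
theorem Fm.sub_up_inst {σ : Ty} (φ : Fm) (s : Sub) (t : Tm σ) :
    (φ.sub (Sub.up σ s)).inst t = φ.sub (scons t s) := by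
  rw [Fm.inst, Fm.sub_sub]
  congr 1; funext τ n
  rw [Sub.up_eq, Tm.sub_scons]
  simp [Tm.wk, Tm.sub_ren, Sub.single_eq, scons_shift, Tm.sub_var, Tm.sub]

theorem Fm.inst_sub {σ : Ty} (φ : Fm) (t : Tm σ) (s : Sub) :
    (φ.inst t).sub s = (φ.sub (Sub.up σ s)).inst (t.sub s) := by
  rw [Fm.sub_up_inst, Fm.inst, Fm.sub_sub]
  congr 1; funext τ n
  rw [Sub.single_eq, Tm.sub_scons]
  simp [Tm.sub]

/-! ### Support of a formula -/

/-- The variables of `t` are among the first `L.count τ` variables of each type `τ`. -/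
def Tm.Supp (L : List Ty) {σ : Ty} (t : Tm σ) : Prop :=
  ∀ s s' : Sub, (∀ τ n, n < L.count τ → s τ n = s' τ n) → t.sub s = t.sub s'

/-- The free variables of `φ` are among the first `L.count τ` variables of each type `τ`. -/
def Fm.Supp (L : List Ty) (φ : Fm) : Prop :=
  ∀ s s' : Sub, (∀ τ n, n < L.count τ → s τ n = s' τ n) → φ.sub s = φ.sub s'

theorem Tm.Supp.mono {L L' : List Ty} (h : ∀ τ, L.count τ ≤ L'.count τ) {σ : Ty} {t : Tm σ}
    (ht : t.Supp L) : t.Supp L' :=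
  fun s s' hs => ht s s' fun τ n hn => hs τ n (hn.trans_le (h τ))

theorem Fm.Supp.mono {L L' : List Ty} (h : ∀ τ, L.count τ ≤ L'.count τ) {φ : Fm}
    (hφ : φ.Supp L) : φ.Supp L' :=
  fun s s' hs => hφ s s' fun τ n hn => hs τ n (hn.trans_le (h τ))

/-- Adding `σ` to the list raises the bound at type `σ` alone by one, exactly the effect of the
binder on indices. Hence supports are lists with multiplicity, from which one variable at a time can
be quantified away. -/
theorem Fm.Supp.all {L : List Ty} {σ : Ty} {φ : Fm} (h : φ.Supp (σ :: L)) :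
    (Fm.all σ φ).Supp L := by
  intro s s' hs
  simp only [Fm.sub]
  congr 1
  apply h
  intro τ n hn
  simp only [Sub.up_eq]
  by_cases hστ : σ = τ
  · subst hστ
    cases n with
    | zero => simp
    | succ n => simp only [scons_succ]; rw [hs]; simpa using hn
  · simp only [scons_of_ne _ _ hστ]
    rw [hs]; simpa [List.count_cons, hστ] using hn

theorem Tm.exists_supp {σ : Ty} (t : Tm σ) : ∃ L, t.Supp L := by
  induction t with
  | var σ n => exact ⟨List.replicate (n + 1) σ, fun s s' h => h σ n (by simp)⟩
  | const c => exact ⟨[], fun _ _ _ => rfl⟩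
  | app f a hf ha =>
    obtain ⟨L, hL⟩ := hf
    obtain ⟨L', hL'⟩ := ha
    refine ⟨L ++ L', fun s s' h => ?_⟩
    simp only [Tm.sub]
    rw [hL.mono (by simp) s s' h, hL'.mono (by simp) s s' h]

theorem Fm.exists_supp (φ : Fm) : ∃ L, φ.Supp L := by
  induction φ with
  | eq a b =>
    obtain ⟨L, hL⟩ := a.exists_supp
    obtain ⟨L', hL'⟩ := b.exists_supp
    refine ⟨L ++ L', fun s s' h => ?_⟩
    simp only [Fm.sub]
    rw [hL.mono (by simp) s s' h, hL'.mono (by simp) s s' h]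
  | st t =>
    obtain ⟨L, hL⟩ := t.exists_supp
    exact ⟨L, fun s s' h => by simp only [Fm.sub]; rw [hL s s' h]⟩
  | bot => exact ⟨[], fun _ _ _ => rfl⟩
  | imp φ ψ hφ hψ =>
    obtain ⟨L, hL⟩ := hφ
    obtain ⟨L', hL'⟩ := hψ
    refine ⟨L ++ L', fun s s' h => ?_⟩
    simp only [Fm.sub]
    rw [hL.mono (by simp) s s' h, hL'.mono (by simp) s s' h]
  | all σ φ ih =>
    obtain ⟨L, hL⟩ := ih
    exact ⟨L, Fm.Supp.all (hL.mono fun τ => List.count_le_count_cons)⟩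

theorem exists_supp_list (Γ : List Fm) : ∃ L, ∀ φ ∈ Γ, φ.Supp L := by
  induction Γ with
  | nil => exact ⟨[], by simp⟩
  | cons φ Γ ih =>
    obtain ⟨L, hL⟩ := ih
    obtain ⟨L', hL'⟩ := φ.exists_supp
    refine ⟨L ++ L', fun ψ hψ => ?_⟩
    rcases List.mem_cons.1 hψ with rfl | hψ
    · exact hL'.mono (by simp)
    · exact (hL ψ hψ).mono (by simp)

/-! ### Derivations are closed under substitution -/

variable {T : Set Fm} {Γ : List Fm} {φ ψ : Fm}

theorem Prf.weaken (h : Prf T Γ φ) : ∀ {Δ : List Fm}, Γ ⊆ Δ → Prf T Δ φ := by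
  induction h with
  | ax h => exact fun _ => .ax h
  | hyp h => exact fun hΔ => .hyp (hΔ h)
  | impI _ ih => exact fun hΔ => .impI (ih (List.cons_subset_cons _ hΔ))
  | impE _ _ ih₁ ih₂ => exact fun hΔ => .impE (ih₁ hΔ) (ih₂ hΔ)
  | raa _ ih => exact fun hΔ => .raa (ih (List.cons_subset_cons _ hΔ))
  | allI _ ih => exact fun hΔ => .allI (ih (List.map_subset _ hΔ))
  | allE t _ ih => exact fun hΔ => .allE t (ih hΔ)

/-- Any substitution `s` splits into its value at `var σ 0` and its values at the shifted variables:
substitute the latter in the closure, then instantiate with the former. -/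
theorem Prf.sub_of_all {σ : Ty} (h : ∀ Γ s, Prf T Γ ((Fm.all σ φ).sub s)) (Γ : List Fm) (s : Sub) :
    Prf T Γ (φ.sub s) := by
  have h' := (h Γ (fun τ n => s τ (Ren.shift σ τ n))).allE (s σ 0)
  rw [Fm.sub_up_inst] at h'
  convert h' using 2
  funext τ n
  by_cases hστ : σ = τ
  · subst hστ; cases n <;> simp [Ren.shift]
  · simp [scons_of_ne _ _ hστ, Ren.shift, Ne.symm hστ]

/-- Quantify the variables of the support away one by one until the formula is closed, where
substitution does nothing, then instantiate again. Derivability in every context makes each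
generalization legitimate. -/
theorem Prf.sub_of_supp (L : List Ty) : ∀ {φ : Fm}, φ.Supp L → (∀ Γ, Prf T Γ φ) →
    ∀ Γ s, Prf T Γ (φ.sub s) := by
  induction L with
  | nil =>
    intro φ hφ h Γ s
    rw [hφ s Tm.var (by simp), Fm.sub_var]
    exact h Γ
  | cons σ L ih =>
    intro φ hφ h
    exact Prf.sub_of_all (ih hφ.all fun Γ => .allI (h _))

theorem Prf.ax_sub (h : φ ∈ T) (Γ : List Fm) (s : Sub) : Prf T Γ (φ.sub s) :=
  have ⟨L, hL⟩ := φ.exists_supp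
  Prf.sub_of_supp L hL (fun _ => .ax h) Γ s

theorem Prf.sub (h : Prf T Γ φ) : ∀ s : Sub, Prf T (Γ.map (Fm.sub s)) (φ.sub s) := by
  induction h with
  | ax h => exact fun s => Prf.ax_sub h _ s
  | hyp h => exact fun s => .hyp (List.mem_map_of_mem h)
  | impI _ ih => exact fun s => .impI (ih s)
  | impE _ _ ih₁ ih₂ => exact fun s => .impE (ih₁ s) (ih₂ s)
  | raa _ ih => exact fun s => .raa (ih s)
  | @allI Γ σ φ _ ih =>
    intro s
    refine .allI ?_
    convert ih (Sub.up σ s) using 1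
    simp [List.map_map, Function.comp_def, Fm.wk_sub_up]
  | @allE Γ σ φ t _ ih =>
    intro s
    rw [Fm.inst_sub]
    exact .allE _ (ih s)

/-- Generalization over a variable that occurs neither in the assumptions nor in the formula. -/
theorem Prf.allI_of_fresh {σ : Ty} {L : List Ty} (hΓ : ∀ ψ ∈ Γ, ψ.Supp L)
    (hφ : (Fm.all σ φ).Supp L) (h : Prf T Γ (φ.inst (Tm.var σ (L.count σ)))) :
    Prf T Γ (Fm.all σ φ) := by
  set y := L.count σ with hy
  -- `s` turns the fresh variable into `var σ 0` and shifts all the others. On formulas with support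
  -- `L` it is plain weakening, while it carries the instance at the fresh variable back to `φ`.
  let s : Sub := fun τ n => if τ = σ ∧ n = y then Tm.var τ 0 else Tm.var τ (Ren.shift σ τ n)
  have hs : ∀ τ n, n < L.count τ → s τ n = Tm.var τ (Ren.shift σ τ n) := by
    intro τ n hn
    have : ¬(τ = σ ∧ n = y) := by rintro ⟨rfl, rfl⟩; omega
    simp [s, this]
  have h' := h.sub s
  refine .allI ?_
  have e₁ : Γ.map (Fm.wk σ) = Γ.map (Fm.sub s) :=
    List.map_congr_left fun ψ hψ => by rw [Fm.wk_eq_sub]; exact (hΓ ψ hψ _ _ hs).symm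
  have e₂ : (φ.inst (Tm.var σ y)).sub s = φ := by
    have h₂ := hφ _ _ hs
    simp only [Fm.sub, Fm.all.injEq, true_and] at h₂
    rw [Fm.inst_sub, h₂, Fm.sub_up_inst]
    conv_rhs => rw [← Fm.sub_var φ]
    congr 1
    funext τ n
    by_cases hστ : σ = τ
    · subst hστ; cases n <;> simp [Tm.sub, s, Ren.shift]
    · simp [scons_of_ne _ _ hστ, Ren.shift, Ne.symm hστ]
  rw [e₁]
  rwa [e₂] at h'


/-! ### Countability of the language -/

/-- An injective coding of types. -/
def Ty.code : Ty → ℕ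
  | .nat => 0
  | .arrow σ τ => Nat.pair 0 (Nat.pair σ.code τ.code) + 1
  | .seq σ => Nat.pair 1 σ.code + 1

theorem Ty.code_inj : ∀ {σ τ : Ty}, σ.code = τ.code → σ = τ
  | .nat, .nat, _ => rfl
  | .nat, .arrow _ _, h | .nat, .seq _, h | .arrow _ _, .nat, h | .seq _, .nat, h => by
    simp [Ty.code] at h
  | .arrow _ _, .seq _, h | .seq _, .arrow _ _, h => by simp [Ty.code, Nat.pair_eq_pair] at h
  | .arrow σ τ, .arrow σ' τ', h => by
    simp only [Ty.code, Nat.add_right_cancel_iff, Nat.pair_eq_pair, true_and] at h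
    rw [Ty.code_inj h.1, Ty.code_inj h.2]
  | .seq σ, .seq σ', h => by
    simp only [Ty.code, Nat.add_right_cancel_iff, Nat.pair_eq_pair, true_and] at h
    rw [Ty.code_inj h]

/-- An injective coding of constants. -/
def Const.code : {σ : Ty} → Const σ → ℕ
  | _, .zero => Nat.pair 0 0
  | _, .succ => Nat.pair 1 0
  | _, .k ρ τ => Nat.pair 2 (Nat.pair ρ.code τ.code)
  | _, .s δ ρ τ => Nat.pair 3 (Nat.pair δ.code (Nat.pair ρ.code τ.code))
  | _, .recursor => Nat.pair 4 0
  | _, .mk σ => Nat.pair 5 σ.code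
  | _, .len σ => Nat.pair 6 σ.code
  | _, .proj σ => Nat.pair 7 σ.code

theorem Const.code_inj {σ τ : Ty} (c : Const σ) (d : Const τ) (h : c.code = d.code) :
    σ = τ ∧ HEq c d := by
  cases c <;> cases d <;> simp [Const.code, Nat.pair_eq_pair] at h <;> try exact ⟨rfl, HEq.rfl⟩
  · rw [Ty.code_inj h.1, Ty.code_inj h.2]; exact ⟨rfl, HEq.rfl⟩
  · rw [Ty.code_inj h.1, Ty.code_inj h.2.1, Ty.code_inj h.2.2]; exact ⟨rfl, HEq.rfl⟩
  all_goals rw [Ty.code_inj h]; exact ⟨rfl, HEq.rfl⟩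

/-- An injective coding of terms. -/
def Tm.code : {σ : Ty} → Tm σ → ℕ
  | _, .var σ n => Nat.pair 0 (Nat.pair σ.code n)
  | _, .const c => Nat.pair 1 c.code
  | _, .app f a => Nat.pair 2 (Nat.pair f.code a.code)

/-- The argument type of an application is not visible in its type, so the types must be compared
along with the terms: the code of the function part determines the argument type. -/
theorem Tm.code_inj {σ : Ty} (t : Tm σ) :
    ∀ {τ : Ty} (u : Tm τ), t.code = u.code → σ = τ ∧ HEq t u := by
  induction t with
  | var σ n =>
    intro τ u h
    cases u <;> simp [Tm.code, Nat.pair_eq_pair] at h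
    obtain ⟨h, rfl⟩ := h
    obtain rfl := Ty.code_inj h
    exact ⟨rfl, HEq.rfl⟩
  | const c =>
    intro τ u h
    cases u <;> simp [Tm.code, Nat.pair_eq_pair] at h
    obtain ⟨rfl, h⟩ := Const.code_inj _ _ h
    rw [eq_of_heq h]
    exact ⟨rfl, HEq.rfl⟩
  | app f a hf ha =>
    intro τ u h
    cases u <;> simp [Tm.code, Nat.pair_eq_pair] at h
    obtain ⟨h₁, h₂⟩ := hf _ h.1
    obtain ⟨rfl, h₃⟩ := ha _ h.2
    obtain ⟨-, rfl⟩ := Ty.arrow.inj h₁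
    rw [eq_of_heq h₂, eq_of_heq h₃]
    exact ⟨rfl, HEq.rfl⟩

/-- An injective coding of formulas. -/
def Fm.code : Fm → ℕ
  | .eq s t => Nat.pair 0 (Nat.pair s.code t.code)
  | .st t => Nat.pair 1 t.code
  | .bot => Nat.pair 2 0
  | .imp φ ψ => Nat.pair 3 (Nat.pair φ.code ψ.code)
  | .all σ φ => Nat.pair 4 (Nat.pair σ.code φ.code)

theorem Fm.code_injective : Function.Injective Fm.code := by
  intro φ
  induction φ with
  | eq s t =>
    intro ψ h
    cases ψ <;> simp [Fm.code, Nat.pair_eq_pair] at h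
    rw [eq_of_heq (Tm.code_inj _ _ h.1).2, eq_of_heq (Tm.code_inj _ _ h.2).2]
  | st t =>
    intro ψ h
    cases ψ <;> simp [Fm.code, Nat.pair_eq_pair] at h
    obtain ⟨rfl, h⟩ := Tm.code_inj _ _ h
    rw [eq_of_heq h]
  | bot =>
    intro ψ h
    cases ψ <;> simp [Fm.code, Nat.pair_eq_pair] at h
    rfl
  | imp φ ψ hφ hψ =>
    intro χ h
    cases χ <;> simp [Fm.code, Nat.pair_eq_pair] at h
    rw [hφ h.1, hψ h.2]
  | all σ φ ih =>
    intro ψ h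
    cases ψ <;> simp [Fm.code, Nat.pair_eq_pair] at h
    obtain rfl := Ty.code_inj h.1
    rw [ih h.2]

instance : Countable Fm := Fm.code_injective.countable

/-! ### Henkin sets -/

/-- A maximal consistent set of formulas with witnesses for universal formulas. -/
structure Henkin (T H : Set Fm) : Prop where
  bot : Fm.bot ∉ H
  imp (φ ψ : Fm) : (φ ⟶ᶠ ψ) ∈ H ↔ (φ ∈ H → ψ ∈ H)
  all (σ : Ty) (φ : Fm) : Fm.all σ φ ∈ H ↔ ∀ t : Tm σ, φ.inst t ∈ H
  ax (φ : Fm) (s : Sub) : φ ∈ T → φ.sub s ∈ H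

/-- Finite sets of assumptions consistent with `T`. -/
def ConList (T : Set Fm) : Type := {Γ : List Fm // ¬Prf T Γ Fm.bot}

instance : Preorder (ConList T) := Preorder.lift fun Γ => {φ | φ ∈ Γ.1}

theorem Prf.exE_neg (h : Prf T (Fm.neg φ :: Γ) Fm.bot) (h' : Prf T (φ :: Γ) Fm.bot) :
    Prf T Γ Fm.bot :=
  (Prf.impI h').impE (Prf.raa h)

/-- `p` decides `φ`, with a witness if `φ` is a refuted universal formula. -/
def ConList.Decides (p : ConList T) (φ : Fm) : Prop :=
  (φ ∈ p.1 ∨ Fm.neg φ ∈ p.1) ∧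
    ∀ σ ψ, φ = Fm.all σ ψ → Fm.neg φ ∈ p.1 → ∃ t : Tm σ, Fm.neg (ψ.inst t) ∈ p.1

/-- If `φ` is consistent with `p`, add it; otherwise its negation is consistent with `p`. When the
refuted formula is universal, a counterexample named by a fresh variable can be added as well: an
inconsistency would allow generalization over that variable and prove the formula. -/
theorem ConList.exists_decides (p : ConList T) (φ : Fm) :
    ∃ q : ConList T, q.Decides φ ∧ p ≤ q := by
  by_cases h : Prf T (φ :: p.1) Fm.bot
  · have hneg : ¬Prf T (Fm.neg φ :: p.1) Fm.bot := fun h' => p.2 (h'.exE_neg h)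
    by_cases hall : ∃ σ ψ, φ = Fm.all σ ψ
    · obtain ⟨σ, ψ, rfl⟩ := hall
      obtain ⟨L, hL⟩ := exists_supp_list (Fm.neg (Fm.all σ ψ) :: p.1)
      have hL' : (Fm.all σ ψ).Supp L := by
        intro s s' hs
        have := hL _ List.mem_cons_self s s' hs
        simp only [Fm.neg, Fm.sub, Fm.imp.injEq, and_true] at this
        exact this
      let t := Tm.var σ (L.count σ)
      refine ⟨⟨Fm.neg (ψ.inst t) :: Fm.neg (Fm.all σ ψ) :: p.1, fun h' => hneg ?_⟩,
        ⟨Or.inr (by simp), ?_⟩, fun χ hχ => by simp at hχ ⊢; tauto⟩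
      · exact (Prf.hyp List.mem_cons_self).impE (Prf.allI_of_fresh hL hL' (Prf.raa h'))
      · rintro σ' ψ' hψ -
        obtain ⟨rfl, rfl⟩ := Fm.all.inj hψ
        exact ⟨t, List.mem_cons_self⟩
    · exact ⟨⟨Fm.neg φ :: p.1, hneg⟩, ⟨Or.inr List.mem_cons_self,
        fun σ ψ h _ => absurd ⟨σ, ψ, h⟩ hall⟩, fun χ hχ => by simp at hχ ⊢; tauto⟩
  · refine ⟨⟨φ :: p.1, h⟩, ⟨Or.inl List.mem_cons_self, fun σ ψ _ h' => absurd ?_ h⟩,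
      fun χ hχ => by simp at hχ ⊢; tauto⟩
    exact (Prf.hyp h').impE (Prf.hyp List.mem_cons_self)

/-- A generic filter argument. There are countably many formulas, and for each of them the
conditions that decide it are cofinal; an ideal containing `p` therefore meets all these sets, and
the union of its members is the Henkin set. -/
theorem exists_henkin (p : ConList T) : ∃ H, Henkin T H ∧ ∀ φ ∈ p.1, φ ∈ H := by
  have := Encodable.ofCountable Fm
  let D : Fm → Order.Cofinal (ConList T) := fun φ =>
    ⟨{q | q.Decides φ}, fun q => (q.exists_decides φ)⟩
  let I := Order.idealOfCofinals p D
  let H : Set Fm := {φ | ∃ q ∈ I, φ ∈ q.1}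
  -- By directedness, finitely many members of `H` already lie in one condition. Derivations use
  -- finitely many assumptions, so `H` inherits consistency.
  have hsub : ∀ Γ : List Fm, (∀ φ ∈ Γ, φ ∈ H) → ∃ q ∈ I, Γ ⊆ q.1 := by
    intro Γ
    induction Γ with
    | nil => exact fun _ => ⟨p, Order.mem_idealOfCofinals p D, by simp⟩
    | cons φ Γ ih =>
      intro h
      obtain ⟨q, hq, hφ⟩ := h φ List.mem_cons_self
      obtain ⟨r, hr, hΓ⟩ := ih fun ψ hψ => h ψ (List.mem_cons_of_mem _ hψ)
      obtain ⟨u, hu, hqu, hru⟩ := I.directed q hq r hr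
      refine ⟨u, hu, ?_⟩
      rintro ψ hψ
      rcases List.mem_cons.1 hψ with rfl | hψ
      · exact hqu hφ
      · exact hru (hΓ hψ)
  have hcon : ∀ Γ : List Fm, (∀ φ ∈ Γ, φ ∈ H) → ¬Prf T Γ Fm.bot := fun Γ h h' =>
    have ⟨q, _, hq⟩ := hsub Γ h
    q.2 (h'.weaken hq)
  have hdec : ∀ φ, φ ∈ H ∨ Fm.neg φ ∈ H := fun φ =>
    have ⟨q, hq, hqI⟩ := Order.cofinal_meets_idealOfCofinals p D φ
    hq.1.imp (fun h => ⟨q, hqI, h⟩) fun h => ⟨q, hqI, h⟩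
  have hded : ∀ (Γ : List Fm) φ, (∀ ψ ∈ Γ, ψ ∈ H) → Prf T Γ φ → φ ∈ H := by
    intro Γ φ hΓ h
    refine (hdec φ).resolve_right fun h' => hcon (Fm.neg φ :: Γ) ?_ ?_
    · simpa using ⟨h', hΓ⟩
    · exact (Prf.hyp List.mem_cons_self).impE (h.weaken (List.subset_cons_self _ _))
  have hbot : Fm.bot ∉ H := fun h => hcon [Fm.bot] (by simpa using h) (.hyp (by simp))
  have hneg : ∀ {φ}, Fm.neg φ ∈ H → φ ∉ H := fun {φ} h h' =>
    hbot (hded [Fm.neg φ, φ] _ (by simpa using ⟨h, h'⟩)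
      ((Prf.hyp (φ := Fm.neg φ) (by simp)).impE (.hyp (by simp))))
  refine ⟨H, ⟨hbot, ?_, ?_, ?_⟩, fun φ hφ => ⟨p, Order.mem_idealOfCofinals p D, hφ⟩⟩
  · intro φ ψ
    constructor
    · intro h h'
      exact hded [φ ⟶ᶠ ψ, φ] _ (by simpa using ⟨h, h'⟩)
        ((Prf.hyp (φ := φ ⟶ᶠ ψ) (by simp)).impE (.hyp (by simp)))
    · intro h
      rcases hdec φ with hφ | hφ
      · exact hded [ψ] _ (by simpa using h hφ) (.impI (.hyp (by simp)))
      · exact hded [Fm.neg φ] _ (by simpa using hφ)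
          (.impI (.raa ((Prf.hyp (φ := Fm.neg φ) (by simp)).impE (.hyp (by simp)))))
  · intro σ φ
    constructor
    · exact fun h t => hded [Fm.all σ φ] _ (by simpa using h) (.allE t (.hyp (by simp)))
    · intro h
      obtain ⟨q, hq, hqI⟩ := Order.cofinal_meets_idealOfCofinals p D (Fm.all σ φ)
      rcases hq.1 with h' | h'
      · exact ⟨q, hqI, h'⟩
      · obtain ⟨t, ht⟩ := hq.2 σ φ rfl h'
        exact absurd (h t) (hneg ⟨q, hqI, ht⟩)
  · exact fun φ s h => hded [] _ (by simp) (Prf.ax_sub h [] s)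

/-! ### Structures and the completeness theorem -/

/-- Structures for the language, with an arbitrary relation interpreting `=₀`. -/
structure Str where
  /-- The objects of each type. -/
  D : Ty → Type
  /-- Application. -/
  app : {σ τ : Ty} → D (σ ⇒ τ) → D σ → D τ
  /-- The values of the constants. -/
  C : {σ : Ty} → Const σ → D σ
  /-- The relation interpreting `=₀`. -/
  E : D N → D N → Prop
  /-- The standard objects. -/
  St : {σ : Ty} → D σ → Prop

namespace Str

/-- Assignments of objects to variables. -/
abbrev Env (M : Str) : Type := (σ : Ty) → ℕ → M.D σ

variable (M : Str)

/-- The value of a term. -/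
def eval (e : M.Env) : {σ : Ty} → Tm σ → M.D σ
  | _, .var σ n => e σ n
  | _, .const c => M.C c
  | _, .app f a => M.app (eval e f) (eval e a)

/-- Satisfaction of a formula. -/
def Sat : M.Env → Fm → Prop
  | e, .eq s t => M.E (M.eval e s) (M.eval e t)
  | e, .st t => M.St (M.eval e t)
  | _, .bot => False
  | e, .imp φ ψ => Sat e φ → Sat e ψ
  | e, .all σ φ => ∀ x : M.D σ, Sat (scons x e) φ

/-- `M` is a model of `T`: the free variables of the axioms are universally quantified. -/
def Models (T : Set Fm) : Prop := ∀ φ ∈ T, ∀ e, M.Sat e φ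

end Str

/-- The term structure given by a set of formulas. -/
def termStr (H : Set Fm) : Str where
  D := Tm
  app := Tm.app
  C := Tm.const
  E s t := Fm.eq s t ∈ H
  St t := Fm.st t ∈ H

theorem eval_termStr (H : Set Fm) (e : Sub) {σ : Ty} (t : Tm σ) :
    (termStr H).eval e t = t.sub e := by
  induction t with
  | app f a hf ha => simp only [Str.eval, Tm.sub, hf, ha]; rfl
  | _ => rfl

/-- The truth lemma: the conditions in `Henkin` are the satisfaction clauses read in the term
structure, where assignments are substitutions. -/
theorem sat_termStr {H : Set Fm} (hH : Henkin T H) (φ : Fm) :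
    ∀ e : Sub, (termStr H).Sat e φ ↔ φ.sub e ∈ H := by
  induction φ with
  | eq s t => intro e; simp only [Str.Sat, eval_termStr]; rfl
  | st t => intro e; simp only [Str.Sat, eval_termStr]; rfl
  | bot => intro e; simpa [Str.Sat, Fm.sub] using hH.bot
  | imp φ ψ hφ hψ => intro e; simp only [Str.Sat, Fm.sub, hH.imp, hφ, hψ]
  | all σ φ ih =>
    intro e
    simp only [Str.Sat, Fm.sub, hH.all, Fm.sub_up_inst]
    exact forall_congr' fun t => ih _

/-- The completeness theorem. -/
theorem provable_of_models (h : ∀ M : Str, M.Models T → ∀ e, M.Sat e φ) : Provable T φ := by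
  by_contra hφ
  obtain ⟨H, hH, hp⟩ := exists_henkin (T := T) ⟨[Fm.neg φ], fun h => hφ (.raa h)⟩
  have hM : (termStr H).Models T := fun ψ hψ e => (sat_termStr hH ψ e).2 (hH.ax ψ e hψ)
  have h₁ := h _ hM Tm.var
  rw [sat_termStr hH, Fm.sub_var] at h₁
  exact hH.bot ((hH.imp _ _).1 (hp (Fm.neg φ) (by simp)) h₁)

namespace Str
variable (M : Str) {σ τ : Ty} (e : M.Env)

/-! ### Evaluation lemmas -/

theorem eval_ren (t : Tm σ) (r : Ren) (e : M.Env) :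
    M.eval e (t.ren r) = M.eval (fun τ n => e τ (r τ n)) t := by
  induction t <;> simp_all [Tm.ren, eval]

@[simp] theorem eval_wk (t : Tm τ) (x : M.D σ) : M.eval (scons x e) (t.wk σ) = M.eval e t := by
  simp only [Tm.wk, eval_ren, scons_shift]

theorem sat_ren (φ : Fm) : ∀ (r : Ren) (e : M.Env),
    M.Sat e (φ.ren r) ↔ M.Sat (fun τ n => e τ (r τ n)) φ := by
  induction φ with
  | all σ φ ih => intro r e; simp only [Fm.ren, Sat, ih, scons_up]
  | _ => intros; simp_all [Fm.ren, Sat, eval_ren]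

theorem eval_sub (t : Tm σ) (s : Sub) (e : M.Env) :
    M.eval e (t.sub s) = M.eval (fun τ n => M.eval e (s τ n)) t := by
  induction t <;> simp_all [Tm.sub, eval]

theorem eval_scons (x : Tm σ) (s : Sub) (τ : Ty) (n : ℕ) :
    M.eval e (scons (D := Tm) x s τ n) =
      scons (D := M.D) (M.eval e x) (fun τ n => M.eval e (s τ n)) τ n :=
  comp_scons (D := Tm) (D' := M.D) (fun _ t => M.eval e t) x s τ n

theorem sat_sub (φ : Fm) : ∀ (s : Sub) (e : M.Env),
    M.Sat e (φ.sub s) ↔ M.Sat (fun τ n => M.eval e (s τ n)) φ := by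
  induction φ with
  | all σ φ ih =>
    intro r e
    simp only [Fm.sub, Sat, ih, Sub.up_eq, eval_scons, eval_wk]
    simp [eval]
  | _ => intros; simp_all [Fm.sub, Sat, eval_sub]

@[simp] theorem sat_inst (φ : Fm) (t : Tm σ) :
    M.Sat e (φ.inst t) ↔ M.Sat (scons (M.eval e t) e) φ := by
  simp only [Fm.inst, sat_sub, Sub.single_eq, eval_scons]
  rfl

@[simp] theorem eval_var (n : ℕ) : M.eval e (.var σ n) = e σ n := rfl

@[simp] theorem eval_app (f : Tm (σ ⇒ τ)) (a : Tm σ) :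
    M.eval e (f ⬝ a) = M.app (M.eval e f) (M.eval e a) := rfl

@[simp] theorem eval_const (c : Const σ) : M.eval e (.const c) = M.C c := rfl

@[simp] theorem sat_st (t : Tm σ) : M.Sat e (.st t) ↔ M.St (M.eval e t) := Iff.rfl

@[simp] theorem sat_bot : M.Sat e .bot ↔ False := Iff.rfl

@[simp] theorem sat_imp (φ ψ : Fm) : M.Sat e (φ ⟶ᶠ ψ) ↔ (M.Sat e φ → M.Sat e ψ) := Iff.rfl

@[simp] theorem sat_all (φ : Fm) : M.Sat e (.all σ φ) ↔ ∀ x : M.D σ, M.Sat (scons x e) φ := Iff.rfl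

@[simp] theorem sat_neg (φ : Fm) : M.Sat e (.neg φ) ↔ ¬M.Sat e φ := Iff.rfl

@[simp] theorem sat_and (φ ψ : Fm) : M.Sat e (φ ⋏ ψ) ↔ M.Sat e φ ∧ M.Sat e ψ := by
  simp [Fm.and]

@[simp] theorem sat_iff (φ ψ : Fm) : M.Sat e (φ.iff ψ) ↔ (M.Sat e φ ↔ M.Sat e ψ) := by
  simp [Fm.iff, iff_def]

@[simp] theorem sat_ex (φ : Fm) : M.Sat e (.ex σ φ) ↔ ∃ x : M.D σ, M.Sat (scons x e) φ := by
  simp [Fm.ex]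

@[simp] theorem sat_allSt (φ : Fm) :
    M.Sat e (.allSt σ φ) ↔ ∀ x : M.D σ, M.St x → M.Sat (scons x e) φ := by
  simp [Fm.allSt]

@[simp] theorem sat_exSt (φ : Fm) :
    M.Sat e (.exSt σ φ) ↔ ∃ x : M.D σ, M.St x ∧ M.Sat (scons x e) φ := by
  simp [Fm.exSt]

/-- The zero object of each type. -/
def zeroD : (σ : Ty) → M.D σ
  | .nat => M.C .zero
  | .arrow σ τ => M.app (M.C (.k τ σ)) (zeroD τ)
  | .seq σ => M.app (M.app (M.C (.mk σ)) (M.C .zero)) (M.app (M.C (.k σ N)) (zeroD σ))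

@[simp] theorem eval_zeroT : ∀ σ, M.eval e (zeroT σ) = M.zeroD σ
  | .nat => rfl
  | .arrow σ τ => by simp [zeroT, zeroD, eval_zeroT τ]
  | .seq σ => by simp [zeroT, zeroD, eval_zeroT σ, mkT, zeroN]

/-- The assignment of zero objects. -/
def env₀ : M.Env := fun σ _ => M.zeroD σ

/-! ### Extensional equality and the extensional quotient -/

/-- The interpretation of `<`. -/
def Lt (i n : M.D N) : Prop := M.Sat (scons i (scons n M.env₀)) (ltF (.var N 0) (.var N 1))

theorem sat_ltF_iff (s t : Tm N) : M.Sat e (ltF s t) ↔ M.Lt (M.eval e s) (M.eval e t) := Iff.rfl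

/-- Extensional equality in type `σ`. -/
def ExtEq : (σ : Ty) → M.D σ → M.D σ → Prop
  | .nat, a, b => M.E a b
  | .arrow _ τ, f, g => ∀ x, ExtEq τ (M.app f x) (M.app g x)
  | .seq σ, s, t => M.E (M.app (M.C (.len σ)) s) (M.app (M.C (.len σ)) t) ∧
      ∀ i, M.Lt i (M.app (M.C (.len σ)) s) →
        ExtEq σ (M.app (M.app (M.C (.proj σ)) s) i) (M.app (M.app (M.C (.proj σ)) t) i)

theorem sat_eqT_iff : ∀ (σ : Ty) (e : M.Env) (s t : Tm σ),
    M.Sat e (eqT σ s t) ↔ M.ExtEq σ (M.eval e s) (M.eval e t)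
  | .nat, _, _, _ => Iff.rfl
  | .arrow σ τ, e, s, t => by
    simp [eqT, ExtEq, sat_eqT_iff τ]
  | .seq σ, e, s, t => by
    simp [eqT, ExtEq, sat_eqT_iff σ, allLt, sat_ltF_iff, projT, lenT, Sat]

variable {M} {T : Set Fm} (hM : M.Models {φ | Pzero φ})
include hM

theorem E_refl (a : M.D N) : M.E a a :=
  hM _ (.epra _ .eq_refl) (scons a M.env₀)

theorem E_symm {a b : M.D N} (h : M.E a b) : M.E b a :=
  hM _ (.epra _ .eq_symm) (scons a (scons b M.env₀)) h

theorem E_trans {a b c : M.D N} (h : M.E a b) (h' : M.E b c) : M.E a c :=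
  hM _ (.epra _ .eq_trans) (scons a (scons b (scons c M.env₀))) h h'

theorem extEq_app_right (f : M.D (σ ⇒ τ)) {x y : M.D σ} (h : M.ExtEq σ x y) :
    M.ExtEq τ (M.app f x) (M.app f y) := by
  have := hM _ (.epra _ (.ext σ τ))
    (fun ρ n => if h : σ ⇒ τ = ρ then h ▸ f else scons x (scons y M.env₀) ρ n)
  -- No type is its own domain, so giving the value `f` to all variables of type `σ ⇒ τ` leaves the
  -- values `x` and `y` at type `σ` untouched.
  have hne : σ ⇒ τ ≠ σ := fun h => by
    have := congrArg sizeOf h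
    simp at this
    omega
  simp only [sat_imp, sat_eqT_iff, eval_app, eval_var, dif_pos, dif_neg hne, scons_zero,
    scons_one] at this
  exact this h

/-- `i < n` is the equation `(i + 1) - n = 0`, and its left side is the recursor applied first to
`n`. Extensionality in that argument suffices. -/
theorem Lt_congr {i a b : M.D N} (h : M.E a b) (hi : M.Lt i a) : M.Lt i b :=
  E_trans hM (E_symm hM (extEq_app_right (σ := N) (τ := N ⇒ (N ⇒ N ⇒ N) ⇒ N) hM
    (M.C .recursor) h _ _)) hi

theorem extEq_refl : ∀ (σ : Ty) (x : M.D σ), M.ExtEq σ x x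
  | .nat, a => E_refl hM a
  | .arrow _ τ, _ => fun _ => extEq_refl τ _
  | .seq σ, _ => ⟨E_refl hM _, fun _ _ => extEq_refl σ _⟩

theorem extEq_symm : ∀ (σ : Ty) {x y : M.D σ}, M.ExtEq σ x y → M.ExtEq σ y x
  | .nat, _, _, h => E_symm hM h
  | .arrow _ τ, _, _, h => fun x => extEq_symm τ (h x)
  | .seq σ, _, _, h => ⟨E_symm hM h.1, fun i hi =>
      extEq_symm σ (h.2 i (Lt_congr hM (E_symm hM h.1) hi))⟩

theorem extEq_trans : ∀ (σ : Ty) {x y z : M.D σ}, M.ExtEq σ x y → M.ExtEq σ y z → M.ExtEq σ x z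
  | .nat, _, _, _, h, h' => E_trans hM h h'
  | .arrow _ τ, _, _, _, h, h' => fun x => extEq_trans τ (h x) (h' x)
  | .seq σ, _, _, _, h, h' => ⟨E_trans hM h.1 h'.1, fun i hi =>
      extEq_trans σ (h.2 i hi) (h'.2 i (Lt_congr hM h.1 hi))⟩

theorem extEq_app {f g : M.D (σ ⇒ τ)} {x y : M.D σ} (hf : M.ExtEq (σ ⇒ τ) f g)
    (h : M.ExtEq σ x y) : M.ExtEq τ (M.app f x) (M.app g y) :=
  extEq_trans hM τ (extEq_app_right hM f h) (hf y)

theorem St_of_extEq {x y : M.D σ} (h : M.ExtEq σ x y) (hx : M.St x) : M.St y := by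
  have := hM _ (.st _ (.eq σ)) (scons x (scons y M.env₀))
  simp only [sat_imp, sat_eqT_iff, eval_var, scons_zero, scons_one, sat_st] at this
  exact this hx h

/-- Extensional equality as a setoid. -/
def extSetoid (σ : Ty) : Setoid (M.D σ) :=
  ⟨M.ExtEq σ, extEq_refl hM σ, extEq_symm hM σ, extEq_trans hM σ⟩

/-- The quotient of `M` by extensional equality. -/
def quot : Str where
  D σ := Quotient (extSetoid hM σ)
  app := Quotient.map₂ M.app fun _ _ hf _ _ hx => extEq_app hM hf hx
  C c := Quotient.mk _ (M.C c)
  E := Eq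
  St := Quotient.lift M.St fun _ _ h =>
    propext ⟨St_of_extEq hM h, St_of_extEq hM (extEq_symm hM _ h)⟩

/-- The class of an object in the quotient. -/
def toQuot {σ : Ty} (x : M.D σ) : (quot hM).D σ := Quotient.mk (extSetoid hM σ) x

theorem toQuot_surjective : Function.Surjective (toQuot hM (σ := σ)) := Quotient.mk_surjective

theorem toQuot_eq_iff {x y : M.D σ} : toQuot hM x = toQuot hM y ↔ M.ExtEq σ x y :=
  Quotient.eq (r := extSetoid hM σ)

theorem eval_quot (e : M.Env) (t : Tm σ) :
    (quot hM).eval (fun τ n => toQuot hM (e τ n)) t = toQuot hM (M.eval e t) := by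
  induction t with
  | app f a hf ha => simp only [eval, hf, ha]; rfl
  | _ => rfl

theorem toQuot_scons (x : M.D σ) (e : M.Env) :
    scons (D := (quot hM).D) (toQuot hM x) (fun τ n => toQuot hM (e τ n)) =
      fun τ n => toQuot hM (scons x e τ n) := by
  funext τ n
  exact (comp_scons (D := M.D) (D' := (quot hM).D) (fun _ => toQuot hM) x e τ n).symm

/-- Atoms are invariant under extensional equality, and quantifiers are preserved because the
quotient map is surjective. -/
theorem sat_quot (φ : Fm) : ∀ e : M.Env,
    (quot hM).Sat (fun τ n => toQuot hM (e τ n)) φ ↔ M.Sat e φ := by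
  induction φ with
  | eq s t => intro e; simp only [Sat, eval_quot]; exact toQuot_eq_iff (σ := N) hM
  | st t => intro e; simp only [Sat, eval_quot]; rfl
  | bot => intro e; rfl
  | imp φ ψ hφ hψ => intro e; simp only [Sat, hφ, hψ]
  | all σ φ ih =>
    intro e
    simp only [Sat, (toQuot_surjective hM).forall, toQuot_scons, ih]

theorem exists_env_quot (e : (quot hM).Env) : ∃ e' : M.Env, (fun τ n => toQuot hM (e' τ n)) = e :=
  ⟨fun τ n => (e τ n).out, by funext τ n; exact Quotient.out_eq _⟩

theorem quot_models (h : M.Models T) : (quot hM).Models T := by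
  intro φ hφ e
  obtain ⟨e, rfl⟩ := exists_env_quot hM e
  exact (sat_quot hM φ e).2 (h φ hφ e)

end Str

/-! ### Extensional models of the base theory -/

/-- Models of the base theory in which equality of each type is true equality. -/
structure EModel extends Str where
  E_iff (a b : D N) : E a b ↔ a = b
  sat_eqT (e : toStr.Env) (σ : Ty) (s t : Tm σ) :
    toStr.Sat e (eqT σ s t) ↔ toStr.eval e s = toStr.eval e t
  models : toStr.Models {φ | Pzero φ}

/-- The completeness theorem for theories that contain the base theory, in terms of
extensional models. -/
theorem provable_of_emodels {T : Set Fm} (hT : {φ | Pzero φ} ⊆ T) {φ : Fm}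
    (h : ∀ M : EModel, M.Models T → ∀ e, M.Sat e φ) : Provable T φ := by
  refine provable_of_models fun M hM e => ?_
  have hM' : M.Models {φ | Pzero φ} := fun φ hφ => hM φ (hT hφ)
  let Q : EModel :=
    { Str.quot hM' with
      E_iff := fun _ _ => Iff.rfl
      sat_eqT := by
        intro e σ s t
        obtain ⟨e, rfl⟩ := Str.exists_env_quot hM' e
        rw [Str.sat_quot, Str.sat_eqT_iff, Str.eval_quot, Str.eval_quot, Str.toQuot_eq_iff]
      models := Str.quot_models hM' hM' }
  exact (Str.sat_quot hM' φ e).1 (h Q (Str.quot_models hM' hM) _)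


-- Quantifier-free formulas and updated assignments

attribute [simp] scons_of_ne Fm.QuantifierFree

@[simp] theorem quantifierFree_neg {φ : Fm} : φ.neg.QuantifierFree ↔ φ.QuantifierFree := by
  simp [Fm.neg]

@[simp] theorem quantifierFree_and {φ ψ : Fm} :
    (φ ⋏ ψ).QuantifierFree ↔ φ.QuantifierFree ∧ ψ.QuantifierFree := by
  simp [Fm.and]

@[simp] theorem quantifierFree_leF (s t : Tm N) : (leF s t).QuantifierFree := trivial

@[simp] theorem quantifierFree_ltF (s t : Tm N) : (ltF s t).QuantifierFree := trivial

/-- Change the value of the variable `var σ n`. -/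
def setVar {D : Ty → Type} (σ : Ty) (n : ℕ) (x : D σ) (e : (τ : Ty) → ℕ → D τ) :
    (τ : Ty) → ℕ → D τ :=
  fun τ m => if h : σ = τ ∧ n = m then h.1 ▸ x else e τ m

@[simp] theorem setVar_self {D : Ty → Type} (σ : Ty) (n : ℕ) (x : D σ)
    (e : (τ : Ty) → ℕ → D τ) : setVar σ n x e σ n = x := by simp [setVar]

theorem setVar_of_ne {D : Ty → Type} (σ : Ty) {n m : ℕ} (h : n ≠ m) (x : D σ)
    (e : (τ : Ty) → ℕ → D τ) (τ : Ty) : setVar σ n x e τ m = e τ m := by simp [setVar, h]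

namespace EModel
variable (M : EModel) {σ τ : Ty}

/-! ### Combinators, recursion, induction and sequences in extensional models -/

theorem epra {φ : Fm} (h : EPRA φ) (e : M.Env) : M.Sat e φ := M.models _ (.epra _ h) e

@[simp] theorem sat_eq (e : M.Env) (s t : Tm N) :
    M.Sat e (.eq s t) ↔ M.eval e s = M.eval e t := M.E_iff _ _

variable {M} in
theorem app_ext {f g : M.D (σ ⇒ τ)} (h : ∀ x, M.app f x = M.app g x) : f = g := by
  have := (M.sat_eqT (scons f (scons g M.env₀)) (σ ⇒ τ) (.var _ 0) (.var _ 1)).1 (by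
    intro x
    rw [M.sat_eqT]
    simp [h])
  simpa using this

/-- The variables of the axiom have different indices, so updating by index gives the right
assignment even when the two types coincide. -/
theorem k_app (x : M.D σ) (y : M.D τ) : M.app (M.app (M.C (.k σ τ)) x) y = x := by
  have := M.epra (.k σ τ) (setVar σ 0 x (setVar τ 1 y M.env₀))
  rw [M.sat_eqT] at this
  simpa [setVar_of_ne] using this

theorem s_app {δ : Ty} (f : M.D (δ ⇒ σ ⇒ τ)) (g : M.D (δ ⇒ σ)) (x : M.D δ) :
    M.app (M.app (M.app (M.C (.s δ σ τ)) f) g) x = M.app (M.app f x) (M.app g x) := by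
  have := M.epra (.s δ σ τ) (setVar _ 0 f (setVar _ 1 g (setVar _ 2 x M.env₀)))
  rw [M.sat_eqT] at this
  simpa [setVar_of_ne] using this

-- The `β`-rule. It makes every function given by a term an object of the model; all functions and
-- trees constructed below arise in this way.
@[simp] theorem app_lam (e : M.Env) (t : Tm τ) (x : M.D σ) :
    M.app (M.eval e (Tm.lam σ t)) x = M.eval (scons x e) t := by
  induction t with
  | var τ n =>
    by_cases h : σ = τ
    · subst h
      cases n <;> simp [Tm.lam, k_app, s_app]
    · simp [Tm.lam, h, k_app]
  | const c => simp [Tm.lam, k_app]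
  | app f a hf ha => simp [Tm.lam, s_app, hf, ha]

/-- The zero of the model. -/
instance : Zero (M.D N) := ⟨M.C .zero⟩

/-- The successor function of the model. -/
def suc (n : M.D N) : M.D N := M.app (M.C .succ) n

@[simp] theorem eval_zeroN (e : M.Env) : M.eval e zeroN = 0 := rfl

@[simp] theorem eval_succT (e : M.Env) (t : Tm N) : M.eval e (succT t) = M.suc (M.eval e t) := rfl

@[simp] theorem zeroD_nat : M.zeroD N = 0 := rfl

@[simp] theorem C_zero : M.C .zero = 0 := rfl

@[simp] theorem C_succ (n : M.D N) : M.app (M.C .succ) n = M.suc n := rfl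

/-- The function defined by primitive recursion from the terms `s` and `b`. -/
def prec (e : M.Env) (s b : Tm N) (n : M.D N) : M.D N :=
  M.app (M.app (M.app (M.C .recursor) n) (M.eval e s)) (M.eval e (Tm.lam N (Tm.lam N b)))

theorem eval_recN (e : M.Env) (t s b : Tm N) :
    M.eval e (recN t s b) = M.prec e s b (M.eval e t) := rfl

@[simp] theorem prec_zero (e : M.Env) (s b : Tm N) : M.prec e s b 0 = M.eval e s := by
  have := M.epra .rec_zero (scons (M.eval e s) (scons (M.eval e (Tm.lam N (Tm.lam N b))) M.env₀))
  simpa [prec] using this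

@[simp] theorem prec_suc (e : M.Env) (s b : Tm N) (n : M.D N) :
    M.prec e s b (M.suc n) = M.eval (scons n (scons (M.prec e s b n) e)) b := by
  have := M.epra .rec_succ (scons (M.eval e s) (scons n
    (scons (M.eval e (Tm.lam N (Tm.lam N b))) M.env₀)))
  simpa [prec] using this

/-- By extensionality, pointwise equal step functions are the same object. This identifies a
recursion term under any assignment with the operation of the model that is defined under a fixed
one. -/
theorem prec_congr {e e' : M.Env} {s s' b b' : Tm N} (hs : M.eval e s = M.eval e' s')
    (hb : ∀ i r : M.D N, M.eval (scons i (scons r e)) b = M.eval (scons i (scons r e')) b') (n : M.D N) :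
    M.prec e s b n = M.prec e' s' b' n := by
  have : M.eval e (Tm.lam N (Tm.lam N b)) = M.eval e' (Tm.lam N (Tm.lam N b')) :=
    app_ext fun r => app_ext fun i => by simp [hb]
  rw [prec, prec, hs, this]

theorem suc_ne_zero (n : M.D N) : M.suc n ≠ 0 := by
  have := M.epra .succ_ne_zero (scons n M.env₀)
  simpa using this

theorem suc_inj {a b : M.D N} (h : M.suc a = M.suc b) : a = b := by
  have := M.epra .succ_inj (scons a (scons b M.env₀))
  simpa [h] using this

variable {M} in
/-- Induction for predicates defined by quantifier-free formulas. -/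
theorem ind_suc {P : M.D N → Prop} (φ : Fm) (hφ : φ.QuantifierFree) (e : M.Env)
    (h : ∀ n, M.Sat (scons n e) φ ↔ P n) (h0 : P 0) (hs : ∀ n, P n → P (M.suc n)) (n : M.D N) :
    P n := by
  have := M.epra (.qf_ind φ hφ) e
  simp only [Str.sat_imp, Str.sat_all, Str.sat_inst, eval_zeroN, h, Str.sat_ren, scons_up,
    scons_shift, eval_succT, Str.eval_var, scons_zero] at this
  exact this h0 hs n

/-! ### Arithmetic -/

/-- Addition of the model. -/
instance : Add (M.D N) := ⟨fun a => M.prec (scons a M.env₀) (.var N 0) (succT (.var N 1))⟩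

@[simp] theorem eval_addT (e : M.Env) (s t : Tm N) :
    M.eval e (addT s t) = M.eval e s + M.eval e t :=
  M.prec_congr (by simp) (by simp) _

theorem add_zero' (a : M.D N) : a + 0 = a := M.prec_zero _ _ _

theorem add_suc (a b : M.D N) : a + M.suc b = M.suc (a + b) := M.prec_suc _ _ _ _

/-- The predecessor function of the model. -/
def pred (n : M.D N) : M.D N := M.prec M.env₀ zeroN (.var N 0) n

@[simp] theorem eval_predT (e : M.Env) (t : Tm N) : M.eval e (predT t) = M.pred (M.eval e t) :=
  M.prec_congr (by simp) (by simp) _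

@[simp] theorem pred_zero : M.pred 0 = 0 := M.prec_zero _ _ _

@[simp] theorem pred_suc (n : M.D N) : M.pred (M.suc n) = n := M.prec_suc _ _ _ _

/-- Truncated subtraction of the model. -/
instance : _root_.Sub (M.D N) := ⟨fun a => M.prec (scons a M.env₀) (.var N 0) (predT (.var N 1))⟩

@[simp] theorem eval_tsubT (e : M.Env) (s t : Tm N) :
    M.eval e (tsubT s t) = M.eval e s - M.eval e t :=
  M.prec_congr (by simp) (by simp) _

theorem sub_zero' (a : M.D N) : a - 0 = a := M.prec_zero _ _ _

theorem sub_suc (a b : M.D N) : a - M.suc b = M.pred (a - b) := by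
  refine (M.prec_suc _ _ _ _).trans ?_
  simp only [eval_predT, Str.eval_var, scons_one, scons_zero]
  rfl

/-- Multiplication of the model. -/
instance : Mul (M.D N) :=
  ⟨fun a => M.prec (scons a M.env₀) zeroN (addT (.var N 1) (.var N 2))⟩

@[simp] theorem eval_mulT (e : M.Env) (s t : Tm N) :
    M.eval e (mulT s t) = M.eval e s * M.eval e t :=
  M.prec_congr (by simp) (by simp) _

theorem mul_zero' (a : M.D N) : a * 0 = 0 := M.prec_zero _ _ _

theorem mul_suc (a b : M.D N) : a * M.suc b = a * b + a := by
  refine (M.prec_suc _ _ _ _).trans ?_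
  simp only [eval_addT, Str.eval_var, scons_one, scons_two, scons_zero]
  rfl

theorem zero_add' (a : M.D N) : 0 + a = a :=
  ind_suc (P := fun a => 0 + a = a) (.eq (addT zeroN (.var N 0)) (.var N 0)) trivial M.env₀
    (by simp) (M.add_zero' 0) (fun n h => by rw [add_suc, h]) a

theorem suc_add (a b : M.D N) : M.suc a + b = M.suc (a + b) :=
  ind_suc (P := fun b => M.suc a + b = M.suc (a + b))
    (.eq (addT (succT (.var N 1)) (.var N 0)) (succT (addT (.var N 1) (.var N 0)))) trivial
    (scons a M.env₀) (by simp) (by simp [add_zero']) (fun n h => by rw [add_suc, add_suc, h]) b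

theorem add_comm' (a b : M.D N) : a + b = b + a :=
  ind_suc (P := fun b => a + b = b + a)
    (.eq (addT (.var N 1) (.var N 0)) (addT (.var N 0) (.var N 1))) trivial
    (scons a M.env₀) (by simp) (by rw [add_zero', zero_add'])
    (fun n h => by rw [add_suc, suc_add, h]) b

theorem add_assoc' (a b c : M.D N) : a + b + c = a + (b + c) :=
  ind_suc (P := fun c => a + b + c = a + (b + c))
    (.eq (addT (addT (.var N 1) (.var N 2)) (.var N 0))
      (addT (.var N 1) (addT (.var N 2) (.var N 0)))) trivial
    (scons a (scons b M.env₀)) (by simp) (by rw [add_zero', add_zero'])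
    (fun n h => by rw [add_suc, add_suc, add_suc, h]) c

theorem add_right_cancel' {a b c : M.D N} : a + c = b + c → a = b :=
  ind_suc (P := fun c => a + c = b + c → a = b)
    (.eq (addT (.var N 1) (.var N 0)) (addT (.var N 2) (.var N 0)) ⟶ᶠ .eq (.var N 1) (.var N 2))
    (by simp) (scons a (scons b M.env₀)) (by simp) (by simp [add_zero'])
    (fun n h h' => h (by rw [add_suc, add_suc] at h'; exact M.suc_inj h')) c

theorem zero_mul' (a : M.D N) : 0 * a = 0 :=
  ind_suc (P := fun a => 0 * a = 0) (.eq (mulT zeroN (.var N 0)) zeroN) trivial M.env₀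
    (by simp) (M.mul_zero' 0) (fun n h => by rw [mul_suc, h, add_zero']) a

theorem suc_mul (a b : M.D N) : M.suc a * b = a * b + b :=
  ind_suc (P := fun b => M.suc a * b = a * b + b)
    (.eq (mulT (succT (.var N 1)) (.var N 0)) (addT (mulT (.var N 1) (.var N 0)) (.var N 0)))
    trivial (scons a M.env₀) (by simp) (by simp [mul_zero', add_zero'])
    (fun n h => by
      rw [mul_suc, mul_suc, h, add_suc, add_suc, add_assoc', add_assoc', M.add_comm' n]) b

theorem mul_comm' (a b : M.D N) : a * b = b * a :=
  ind_suc (P := fun b => a * b = b * a)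
    (.eq (mulT (.var N 1) (.var N 0)) (mulT (.var N 0) (.var N 1))) trivial
    (scons a M.env₀) (by simp) (by rw [mul_zero', zero_mul'])
    (fun n h => by rw [mul_suc, suc_mul, h]) b

theorem mul_add' (a b c : M.D N) : a * (b + c) = a * b + a * c :=
  ind_suc (P := fun c => a * (b + c) = a * b + a * c)
    (.eq (mulT (.var N 1) (addT (.var N 2) (.var N 0)))
      (addT (mulT (.var N 1) (.var N 2)) (mulT (.var N 1) (.var N 0)))) trivial
    (scons a (scons b M.env₀)) (by simp) (by rw [add_zero', mul_zero', add_zero'])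
    (fun n h => by rw [add_suc, mul_suc, mul_suc, h, add_assoc']) c

theorem mul_assoc' (a b c : M.D N) : a * b * c = a * (b * c) :=
  ind_suc (P := fun c => a * b * c = a * (b * c))
    (.eq (mulT (mulT (.var N 1) (.var N 2)) (.var N 0))
      (mulT (.var N 1) (mulT (.var N 2) (.var N 0)))) trivial
    (scons a (scons b M.env₀)) (by simp) (by rw [mul_zero', mul_zero', mul_zero'])
    (fun n h => by rw [mul_suc, mul_suc, mul_add', h]) c

/-- The numbers of a model form a commutative semiring. -/
instance : CommSemiring (M.D N) where
  one := M.suc 0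
  add_assoc := M.add_assoc'
  zero_add := M.zero_add'
  add_zero := M.add_zero'
  add_comm := M.add_comm'
  nsmul := nsmulRec
  left_distrib := M.mul_add'
  right_distrib a b c := by rw [M.mul_comm', M.mul_add', M.mul_comm' c, M.mul_comm' c]
  zero_mul := M.zero_mul'
  mul_zero := M.mul_zero'
  mul_assoc := M.mul_assoc'
  one_mul a := by
    refine (M.suc_mul 0 a).trans ?_
    rw [M.zero_mul', M.zero_add']
  mul_one a := by
    refine (M.mul_suc a 0).trans ?_
    rw [M.mul_zero', M.zero_add']
  mul_comm := M.mul_comm'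

instance : IsCancelAdd (M.D N) where
  add_left_cancel a b c h := M.add_right_cancel' (c := a) (by rw [add_comm b, add_comm c]; exact h)
  add_right_cancel _ _ _ h := M.add_right_cancel' h

@[simp] theorem suc_eq (n : M.D N) : M.suc n = n + 1 := by
  refine Eq.symm ((M.add_suc n 0).trans ?_)
  rw [add_zero]

@[simp] theorem pred_add_one (n : M.D N) : M.pred (n + 1) = n := by rw [← suc_eq, pred_suc]

theorem add_one_ne_zero' (n : M.D N) : n + 1 ≠ 0 := by rw [← suc_eq]; exact M.suc_ne_zero n

theorem sub_add_one (a b : M.D N) : a - (b + 1) = M.pred (a - b) := by rw [← suc_eq, sub_suc]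

variable {M} in
/-- Induction for predicates defined by quantifier-free formulas. -/
theorem ind {P : M.D N → Prop} (φ : Fm) (hφ : φ.QuantifierFree) (e : M.Env)
    (h : ∀ n, M.Sat (scons n e) φ ↔ P n) (h0 : P 0) (hs : ∀ n, P n → P (n + 1)) (n : M.D N) :
    P n :=
  ind_suc φ hφ e h h0 (fun n hn => by rw [suc_eq]; exact hs n hn) n

/-- The existential statement is not available for induction; the predecessor provides the witness
and makes it quantifier-free. -/
theorem eq_zero_or_eq_add_one (n : M.D N) : n = 0 ∨ ∃ m, n = m + 1 := by
  have := ind (P := fun n => ¬n = 0 → n = M.pred n + 1)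
    (.neg (.eq (.var N 0) zeroN) ⟶ᶠ .eq (.var N 0) (succT (predT (.var N 0)))) (by simp) M.env₀
    (by simp) (by simp) (by simp) n
  by_cases h : n = 0
  · exact .inl h
  · exact .inr ⟨_, this h⟩

theorem add_one_sub_add_one (a b : M.D N) : a + 1 - (b + 1) = a - b :=
  ind (P := fun b => a + 1 - (b + 1) = a - b)
    (.eq (tsubT (succT (.var N 1)) (succT (.var N 0))) (tsubT (.var N 1) (.var N 0))) trivial
    (scons a M.env₀) (by simp) (by rw [sub_add_one, sub_zero', sub_zero', pred_add_one])
    (fun n h => by rw [sub_add_one, h, sub_add_one]) b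

theorem sub_self' (a : M.D N) : a - a = 0 :=
  ind (P := fun a => a - a = 0) (.eq (tsubT (.var N 0) (.var N 0)) zeroN) trivial M.env₀
    (by simp) (M.sub_zero' 0) (fun n h => by rw [add_one_sub_add_one, h]) a

theorem sub_add_self (a c : M.D N) : a - (a + c) = 0 :=
  ind (P := fun c => a - (a + c) = 0) (.eq (tsubT (.var N 1) (addT (.var N 1) (.var N 0))) zeroN)
    trivial (scons a M.env₀) (by simp) (by rw [add_zero, sub_self'])
    (fun n h => by rw [← add_assoc, sub_add_one, h, pred_zero]) c

theorem add_sub_self (a c : M.D N) : a + c - a = c :=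
  ind (P := fun a => a + c - a = c) (.eq (tsubT (addT (.var N 0) (.var N 1)) (.var N 0)) (.var N 1))
    trivial (scons c M.env₀) (by simp) (by rw [zero_add, sub_zero'])
    (fun n h => by rw [add_right_comm, add_one_sub_add_one, h]) a

theorem sub_eq_zero_or (a b : M.D N) : a - b = 0 ∨ a = b + (a - b) := by
  have := ind (P := fun b => ¬a - b = 0 → a = b + (a - b))
    (.neg (.eq (tsubT (.var N 1) (.var N 0)) zeroN) ⟶ᶠ
      .eq (.var N 1) (addT (.var N 0) (tsubT (.var N 1) (.var N 0)))) (by simp) (scons a M.env₀)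
    (by simp) (by simp [sub_zero']) (by
      intro n hn h
      rw [sub_add_one] at h ⊢
      rcases M.eq_zero_or_eq_add_one (a - n) with h' | ⟨m, hm⟩
      · simp [h'] at h
      · have := hn (by rw [hm]; exact M.add_one_ne_zero' m)
        rw [hm] at this ⊢
        rw [pred_add_one]
        nth_rewrite 1 [this]
        ring) b
  by_cases h : a - b = 0
  · exact .inl h
  · exact .inr (this h)

/-- Truncated subtraction supplies the witness, which links the formal order `a - b = 0` to the
algebraic one, `b = a + c`. -/
theorem eq_add_of_sub_eq_zero (a b : M.D N) : a - b = 0 → b = a + (b - a) :=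
  ind (P := fun a => a - b = 0 → b = a + (b - a))
    (.eq (tsubT (.var N 0) (.var N 1)) zeroN ⟶ᶠ
      .eq (.var N 1) (addT (.var N 0) (tsubT (.var N 1) (.var N 0)))) (by simp) (scons b M.env₀)
    (by simp) (by simp [sub_zero']) (by
      intro n hn h
      have h₁ : n - b = 0 := by
        rcases M.sub_eq_zero_or n b with h' | h'
        · exact h'
        · rcases M.eq_zero_or_eq_add_one (n - b) with h₂ | ⟨m, hm⟩
          · exact h₂
          · have h₃ := M.sub_add_one (n + 1) b
            rw [add_one_sub_add_one, h, pred_zero] at h₃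
            exact h₃
      have h₂ := hn h₁
      rcases M.eq_zero_or_eq_add_one (b - n) with h₃ | ⟨m, hm⟩
      · rw [h₃, add_zero] at h₂
        rw [h₂] at h
        have h₄ := M.add_sub_self n 1
        rw [h] at h₄
        exact absurd h₄.symm (by simpa using M.add_one_ne_zero' 0)
      · rw [sub_add_one, hm, pred_add_one]
        rw [hm] at h₂
        rw [h₂]
        ring) a

/-! ### The numbers of a model as an ordered semiring -/

/-- The order of the model. -/
instance : LE (M.D N) := ⟨fun a b => a - b = 0⟩

theorem le_def' (a b : M.D N) : a ≤ b ↔ a - b = 0 := Iff.rfl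

theorem le_iff_exists (a b : M.D N) : a ≤ b ↔ ∃ c, b = a + c := by
  constructor
  · exact fun h => ⟨_, M.eq_add_of_sub_eq_zero a b h⟩
  · rintro ⟨c, rfl⟩
    exact M.sub_add_self a c

theorem eq_zero_of_add_eq_zero {a b : M.D N} (h : a + b = 0) : a = 0 := by
  rcases M.eq_zero_or_eq_add_one a with h' | ⟨m, rfl⟩
  · exact h'
  · rw [add_right_comm] at h
    exact absurd h (M.add_one_ne_zero' _)

noncomputable instance : LinearOrder (M.D N) where
  le_refl := M.sub_self'
  le_trans a b c hab hbc := by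
    rw [le_iff_exists] at *
    obtain ⟨d, rfl⟩ := hab
    obtain ⟨d', rfl⟩ := hbc
    exact ⟨d + d', add_assoc _ _ _⟩
  le_antisymm a b hab hba := by
    rw [le_iff_exists] at *
    obtain ⟨d, rfl⟩ := hab
    obtain ⟨d', h⟩ := hba
    have : d + d' = 0 := by
      rw [add_assoc] at h
      exact add_left_cancel (a := a) (by rw [← h, add_zero])
    rw [M.eq_zero_of_add_eq_zero this, add_zero]
  le_total a b := by
    rcases M.sub_eq_zero_or a b with h | h
    · exact .inl h
    · exact .inr ((M.le_iff_exists _ _).2 ⟨_, h⟩)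
  toDecidableLE := Classical.decRel _

instance : CanonicallyOrderedAdd (M.D N) where
  exists_add_of_le h := (M.le_iff_exists _ _).1 h
  le_add_self _ b := (M.le_iff_exists _ _).2 ⟨b, add_comm _ _⟩
  le_self_add _ b := (M.le_iff_exists _ _).2 ⟨b, rfl⟩

instance : IsOrderedCancelAddMonoid (M.D N) where
  add_le_add_left a b h c := by
    obtain ⟨d, rfl⟩ := exists_add_of_le h
    exact (M.le_iff_exists _ _).2 ⟨d, by ring⟩
  le_of_add_le_add_left a b c h := by
    obtain ⟨d, h⟩ := exists_add_of_le h
    rw [add_assoc] at h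
    exact (M.le_iff_exists _ _).2 ⟨d, add_left_cancel h⟩

instance : IsOrderedRing (M.D N) where
  zero_le_one := zero_le
  mul_le_mul_of_nonneg_left a _ b c h := by
    obtain ⟨d, rfl⟩ := exists_add_of_le h
    exact (M.le_iff_exists _ _).2 ⟨a * d, by ring⟩
  mul_le_mul_of_nonneg_right a _ b c h := by
    obtain ⟨d, rfl⟩ := exists_add_of_le h
    exact (M.le_iff_exists _ _).2 ⟨d * a, by ring⟩

instance : OrderedSub (M.D N) where
  tsub_le_iff_right a b c := by
    rcases M.sub_eq_zero_or a b with h | h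
    · rw [h]
      exact ⟨fun _ => le_trans (show a ≤ b from h) le_add_self, fun _ => zero_le⟩
    · nth_rewrite 2 [h]
      rw [add_comm, add_le_add_iff_right]

theorem lt_iff_add_one_le {a b : M.D N} : a < b ↔ a + 1 ≤ b := by
  constructor
  · intro h
    obtain ⟨c, rfl⟩ := exists_add_of_le h.le
    rcases M.eq_zero_or_eq_add_one c with rfl | ⟨m, rfl⟩
    · simp at h
    · exact (M.le_iff_exists _ _).2 ⟨m, by ring⟩
  · intro h
    refine lt_of_lt_of_le (lt_of_le_of_ne le_self_add fun h' => ?_) h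
    exact M.add_one_ne_zero' 0 (by rw [zero_add]; exact (left_eq_add.1 h'))

theorem lt_add_one_iff' {a b : M.D N} : a < b + 1 ↔ a ≤ b := by
  rw [lt_iff_add_one_le, add_le_add_iff_right]

instance : Nontrivial (M.D N) := ⟨⟨0 + 1, 0, M.add_one_ne_zero' 0⟩⟩

instance : IsStrictOrderedRing (M.D N) :=
  { (inferInstance : IsOrderedRing (M.D N)), (inferInstance : IsOrderedCancelAddMonoid (M.D N)),
    (inferInstance : Nontrivial (M.D N)) with
    mul_lt_mul_of_pos_left := by
      intro a ha b c h
      obtain ⟨d, rfl⟩ := exists_add_of_le (M.lt_iff_add_one_le.1 h)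
      have h₁ : a * (b + 1 + d) = a * b + (a + a * d) := by ring
      change a * b < a * (b + 1 + d)
      rw [h₁]
      exact lt_add_of_pos_right _ (lt_of_lt_of_le ha le_self_add)
    mul_lt_mul_of_pos_right := by
      intro a ha b c h
      obtain ⟨d, rfl⟩ := exists_add_of_le (M.lt_iff_add_one_le.1 h)
      have h₁ : (b + 1 + d) * a = b * a + (a + a * d) := by ring
      change b * a < (b + 1 + d) * a
      rw [h₁]
      exact lt_add_of_pos_right _ (lt_of_lt_of_le ha le_self_add) }

@[simp] theorem sat_leF (e : M.Env) (s t : Tm N) :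
    M.Sat e (leF s t) ↔ M.eval e s ≤ M.eval e t := by
  rw [leF, sat_eq, eval_tsubT, eval_zeroN]; rfl

@[simp] theorem sat_ltF (e : M.Env) (s t : Tm N) :
    M.Sat e (ltF s t) ↔ M.eval e s < M.eval e t := by
  rw [ltF, sat_leF, lt_iff_add_one_le, eval_succT, suc_eq]

end EModel
namespace EModel
variable (M : EModel) {σ τ : Ty}

/-! ### Finite sequences and standard objects -/

/-- The length of a sequence. -/
def len (s : M.D (.seq σ)) : M.D N := M.app (M.C (.len σ)) s

/-- The function `i ↦ s_i` of a sequence. -/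
def entries (s : M.D (.seq σ)) : M.D (N ⇒ σ) := M.app (M.C (.proj σ)) s

/-- The sequence of the first `n` values of `f`. -/
def mkSeq (n : M.D N) (f : M.D (N ⇒ σ)) : M.D (.seq σ) := M.app (M.app (M.C (.mk σ)) n) f

@[simp] theorem C_len (s : M.D (.seq σ)) : M.app (M.C (.len σ)) s = M.len s := rfl

@[simp] theorem C_proj (s : M.D (.seq σ)) : M.app (M.C (.proj σ)) s = M.entries s := rfl

@[simp] theorem C_mk (n : M.D N) (f : M.D (N ⇒ σ)) :
    M.app (M.app (M.C (.mk σ)) n) f = M.mkSeq n f := rfl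

@[simp] theorem eval_lenT (e : M.Env) (s : Tm (.seq σ)) :
    M.eval e (lenT s) = M.len (M.eval e s) := rfl

@[simp] theorem eval_projT (e : M.Env) (s : Tm (.seq σ)) (i : Tm N) :
    M.eval e (projT s i) = M.app (M.entries (M.eval e s)) (M.eval e i) := rfl

@[simp] theorem eval_mkT (e : M.Env) (n : Tm N) (f : Tm (N ⇒ σ)) :
    M.eval e (mkT n f) = M.mkSeq (M.eval e n) (M.eval e f) := rfl

@[simp] theorem sat_allLt (e : M.Env) (t : Tm N) (φ : Fm) :
    M.Sat e (allLt t φ) ↔ ∀ i < M.eval e t, M.Sat (scons i e) φ := by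
  simp [allLt]

@[simp] theorem len_mkSeq (n : M.D N) (f : M.D (N ⇒ σ)) : M.len (M.mkSeq n f) = n := by
  have := M.epra (.len_mk σ) (scons n (scons f M.env₀))
  simpa using this

theorem entries_mkSeq {n i : M.D N} (f : M.D (N ⇒ σ)) (h : i < n) :
    M.app (M.entries (M.mkSeq n f)) i = M.app f i := by
  have := M.epra (.proj_mk σ) (scons n (scons i (scons f M.env₀)))
  rw [Str.sat_imp, sat_ltF, M.sat_eqT] at this
  simpa using this (by simpa using h)

theorem entries_of_le (s : M.D (.seq σ)) {i : M.D N} (h : M.len s ≤ i) :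
    M.app (M.entries s) i = M.zeroD σ := by
  have := M.epra (.proj_ge σ) (scons i (scons s M.env₀))
  rw [Str.sat_imp, sat_leF, M.sat_eqT] at this
  simpa using this (by simpa using h)

variable {M} in
theorem seq_ext {s t : M.D (.seq σ)} (h : M.len s = M.len t)
    (h' : ∀ i < M.len s, M.app (M.entries s) i = M.app (M.entries t) i) : s = t := by
  have := (M.sat_eqT (scons s (scons t M.env₀)) (.seq σ) (.var _ 0) (.var _ 1)).1 (by
    simp only [eqT, Str.sat_and, sat_eq, eval_lenT, sat_allLt, M.sat_eqT]
    simpa using ⟨h, h'⟩)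
  simpa using this

theorem mkSeq_congr {n : M.D N} {f g : M.D (N ⇒ σ)} (h : ∀ i < n, M.app f i = M.app g i) :
    M.mkSeq n f = M.mkSeq n g :=
  seq_ext (by simp) fun i hi => by
    rw [len_mkSeq] at hi
    rw [entries_mkSeq M _ hi, entries_mkSeq M _ hi, h i hi]

theorem st_app {f : M.D (σ ⇒ τ)} {x : M.D σ} (hf : M.St f) (hx : M.St x) : M.St (M.app f x) := by
  have := M.models _ (.st _ (.app σ τ)) (setVar _ 0 f (setVar _ 1 x M.env₀))
  simp only [Str.sat_imp, Str.sat_st, Str.eval_app, Str.eval_var, setVar_self,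
    setVar_of_ne _ zero_ne_one] at this
  exact this hf hx

theorem st_eval (e : M.Env) {t : Tm σ} (ht : t.Closed) : M.St (M.eval e t) :=
  M.models _ (.st _ (.closed σ t ht)) e

theorem st_zero : M.St (0 : M.D N) := M.st_eval M.env₀ (t := zeroN) trivial

theorem st_add_one {n : M.D N} (h : M.St n) : M.St (n + 1) := by
  rw [← suc_eq]
  exact M.st_app (M.st_eval M.env₀ (t := .const .succ) trivial) h

theorem st_pred {n : M.D N} (h : M.St n) : M.St (M.pred n) := by
  have := M.st_app (M.st_eval M.env₀
    (t := Tm.lam N (predT (.var N 0))) (by simp [predT, recN, zeroN, Tm.lam, Tm.Closed])) h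
  simpa using this

theorem sat_allMem (e : M.Env) (w : Tm (.seq σ)) (φ : Fm) :
    M.Sat e (allMem w φ) ↔
      ∀ i < M.len (M.eval e w), M.Sat (scons (M.app (M.entries (M.eval e w)) i) e) φ := by
  simp only [allMem, sat_allLt, eval_lenT, Str.sat_inst, eval_projT, Str.eval_wk, Str.eval_var,
    scons_zero, Str.sat_ren, scons_up, scons_shift]

/-! ### Bounded sums, bounded quantifiers and bounded search -/

/-- The sum of the first `n` values of `F`. -/
def sum (F : M.D One) : M.D N → M.D N :=
  M.prec (scons F M.env₀) zeroN (addT (.var N 1) (.var One 0 ⬝ .var N 0))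

/-- The term for `sum`. -/
def sumT (F : Tm One) (n : Tm N) : Tm N :=
  recN n zeroN (addT (.var N 1) ((F.wk N).wk N ⬝ .var N 0))

@[simp] theorem eval_sumT (e : M.Env) (F : Tm One) (n : Tm N) :
    M.eval e (sumT F n) = M.sum (M.eval e F) (M.eval e n) :=
  M.prec_congr (by simp) (by simp) _

@[simp] theorem sum_zero (F : M.D One) : M.sum F 0 = 0 := M.prec_zero _ _ _

theorem sum_succ (F : M.D One) (n : M.D N) : M.sum F (n + 1) = M.sum F n + M.app F n := by
  rw [← suc_eq]
  refine (M.prec_suc _ _ _ _).trans ?_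
  simp [sum]

theorem sum_le_sum_add (F : M.D One) (n d : M.D N) : M.sum F n ≤ M.sum F (n + d) :=
  ind (P := fun d => M.sum F n ≤ M.sum F (n + d))
    (leF (sumT (.var One 0) (.var N 1)) (sumT (.var One 0) (addT (.var N 1) (.var N 0))))
    (by simp) (scons n (scons F M.env₀)) (by simp) (by simp)
    (fun m h => by rw [← add_assoc, sum_succ]; exact h.trans le_self_add) d

theorem sum_mono (F : M.D One) {m n : M.D N} (h : m ≤ n) : M.sum F m ≤ M.sum F n := by
  obtain ⟨d, rfl⟩ := exists_add_of_le h
  exact M.sum_le_sum_add F m d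

theorem le_sum (F : M.D One) {i n : M.D N} (h : i < n) : M.app F i ≤ M.sum F n := by
  refine le_trans ?_ (M.sum_mono F (M.lt_iff_add_one_le.1 h))
  rw [sum_succ]
  exact le_add_self

/-- If every interval of length `q` contains an argument at which `F` has the value `1`, then the
sum of the first `q * l` values of `F` is at least `l`. -/
theorem le_sum_mul (F : M.D One) (q : M.D N)
    (h : ∀ l, ∃ j, q * l ≤ j ∧ j < q * (l + 1) ∧ M.app F j = 1) (l : M.D N) :
    l ≤ M.sum F (q * l) :=
  ind (P := fun l => l ≤ M.sum F (q * l))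
    (leF (.var N 0) (sumT (.var One 0) (mulT (.var N 1) (.var N 0)))) (by simp)
    (scons q (scons F M.env₀)) (by simp) (by simp) (fun l hl => by
      obtain ⟨j, hj, hj', hF⟩ := h l
      calc l + 1 ≤ M.sum F (q * l) + 1 := by gcongr
        _ ≤ M.sum F j + 1 := by gcongr; exact M.sum_mono F hj
        _ = M.sum F (j + 1) := by rw [sum_succ, hF]
        _ ≤ _ := M.sum_mono F (M.lt_iff_add_one_le.1 hj')) l

theorem le_one_iff {a : M.D N} : a ≤ 1 ↔ a = 0 ∨ a = 1 := by
  constructor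
  · intro h
    rcases M.eq_zero_or_eq_add_one a with h' | ⟨m, rfl⟩
    · exact .inl h'
    · have : m ≤ 0 := by rwa [← add_le_add_iff_right 1, zero_add]
      rw [nonpos_iff_eq_zero.1 this, zero_add]
      exact .inr rfl
  · rintro (rfl | rfl)
    · exact zero_le
    · exact le_rfl

theorem one_sub_le_one (a : M.D N) : 1 - a ≤ 1 := tsub_le_self

theorem one_sub_eq_one_iff {a : M.D N} : 1 - a = 1 ↔ a = 0 := by
  constructor
  · intro h
    rcases M.eq_zero_or_eq_add_one a with h' | ⟨m, rfl⟩
    · exact h'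
    · have : (1 : M.D N) - (m + 1) = 0 := tsub_eq_zero_of_le le_add_self
      rw [this] at h
      exact absurd h zero_ne_one
  · rintro rfl
    exact tsub_zero _

/-- The function `n ↦ 1` if `F i = 0` for all `i < n`, and `0` otherwise. -/
def allZero (F : M.D One) : M.D N → M.D N :=
  M.prec (scons F M.env₀) (succT zeroN)
    (mulT (.var N 1) (tsubT (succT zeroN) (.var One 0 ⬝ .var N 0)))

/-- The term for `allZero`. -/
def allZeroT (F : Tm One) (n : Tm N) : Tm N :=
  recN n (succT zeroN) (mulT (.var N 1) (tsubT (succT zeroN) ((F.wk N).wk N ⬝ .var N 0)))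

@[simp] theorem eval_allZeroT (e : M.Env) (F : Tm One) (n : Tm N) :
    M.eval e (allZeroT F n) = M.allZero (M.eval e F) (M.eval e n) :=
  M.prec_congr (by simp) (by simp) _

@[simp] theorem allZero_zero (F : M.D One) : M.allZero F 0 = 1 :=
  (M.prec_zero _ _ _).trans (by simp)

theorem allZero_succ (F : M.D One) (n : M.D N) :
    M.allZero F (n + 1) = M.allZero F n * (1 - M.app F n) := by
  rw [← suc_eq]
  refine (M.prec_suc _ _ _ _).trans ?_
  simp [allZero]

theorem allZero_le_one (F : M.D One) (n : M.D N) : M.allZero F n ≤ 1 :=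
  ind (P := fun n => M.allZero F n ≤ 1) (leF (allZeroT (.var One 0) (.var N 0)) (succT zeroN))
    (by simp) (scons F M.env₀) (by simp) (by simp)
    (fun n h => by
      rw [allZero_succ]
      exact mul_le_one' h (M.one_sub_le_one _)) n

/-- The product of the factors `1 - F i` expresses a bounded quantifier by an equation between
terms. This allows trees to be defined by bounded conditions. -/
theorem allZero_eq_one_iff (F : M.D One) (n : M.D N) :
    M.allZero F n = 1 ↔ ∀ i < n, M.app F i = 0 := by
  constructor
  · intro h i hi
    refine ind (P := fun n => M.allZero F n = 1 → i < n → M.app F i = 0)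
      (.eq (allZeroT (.var One 0) (.var N 0)) (succT zeroN) ⟶ᶠ ltF (.var N 1) (.var N 0) ⟶ᶠ
        .eq (.var One 0 ⬝ .var N 1) zeroN) (by simp) (scons i (scons F M.env₀)) (by simp)
      (by simp) (fun n ih h hi => ?_) n h hi
    rw [allZero_succ] at h
    rcases M.le_one_iff.1 (M.allZero_le_one F n) with h' | h'
    · simp [h'] at h
    · rw [h', one_mul, one_sub_eq_one_iff] at h
      rcases (M.lt_add_one_iff'.1 hi).lt_or_eq with hi | rfl
      · exact ih h' hi
      · exact h
  · intro h
    -- The hypothesis covers only arguments below `n`, so the induction variable is kept below `n`;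
    -- the quantified hypothesis itself stays outside the induction formula.
    refine ind (P := fun m => m ≤ n → M.allZero F m = 1)
      (leF (.var N 0) (.var N 1) ⟶ᶠ .eq (allZeroT (.var One 0) (.var N 0)) (succT zeroN))
      (by simp) (scons n (scons F M.env₀)) (by simp) (by simp) (fun m ih hm => ?_) n le_rfl
    have hm' := M.lt_iff_add_one_le.2 hm
    rw [allZero_succ, ih hm'.le, h m hm', one_mul, tsub_zero]

/-- The least argument below `n` at which `F` vanishes, or `n`, for `F` with values at most `1`. -/
def search (F : M.D One) : M.D N → M.D N :=
  M.prec (scons F M.env₀) zeroN (addT (.var N 1) (.var One 0 ⬝ .var N 1))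

/-- The term for `search`. -/
def searchT (F : Tm One) (n : Tm N) : Tm N :=
  recN n zeroN (addT (.var N 1) ((F.wk N).wk N ⬝ .var N 1))

@[simp] theorem eval_searchT (e : M.Env) (F : Tm One) (n : Tm N) :
    M.eval e (searchT F n) = M.search (M.eval e F) (M.eval e n) :=
  M.prec_congr (by simp) (by simp) _

@[simp] theorem search_zero (F : M.D One) : M.search F 0 = 0 := M.prec_zero _ _ _

theorem search_succ (F : M.D One) (n : M.D N) :
    M.search F (n + 1) = M.search F n + M.app F (M.search F n) := by
  rw [← suc_eq]
  refine (M.prec_suc _ _ _ _).trans ?_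
  simp [search]

/-- The search advances by the value of `F` at its current position, so it moves while that value is
`1` and stays forever at the first zero. A position other than `n` after `n` steps means that a zero
has been reached. -/
theorem search_spec (F : M.D One) (hF : ∀ n, M.app F n ≤ 1) (n : M.D N) :
    ¬M.search F n = n → M.app F (M.search F n) = 0 :=
  ind (P := fun n => ¬M.search F n = n → M.app F (M.search F n) = 0)
    (.neg (.eq (searchT (.var One 0) (.var N 0)) (.var N 0)) ⟶ᶠ
      .eq (.var One 0 ⬝ searchT (.var One 0) (.var N 0)) zeroN) (by simp) (scons F M.env₀)
    (by simp) (by simp) (fun n ih h => by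
      rw [search_succ] at h ⊢
      rcases M.le_one_iff.1 (hF (M.search F n)) with h' | h'
      · rw [h', add_zero, h']
      · have := mt ih (by rw [h']; exact one_ne_zero)
        rw [h', not_not.1 this] at h
        exact absurd rfl h) n

theorem eq_one_of_lt_search (F : M.D One) (hF : ∀ n, M.app F n ≤ 1) {i n : M.D N} :
    i < M.search F n → M.app F i = 1 :=
  ind (P := fun n => i < M.search F n → M.app F i = 1)
    (ltF (.var N 1) (searchT (.var One 0) (.var N 0)) ⟶ᶠ
      .eq (.var One 0 ⬝ .var N 1) (succT zeroN)) (by simp) (scons i (scons F M.env₀))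
    (by simp) (by simp) (fun n ih h => by
      rw [search_succ] at h
      rcases M.le_one_iff.1 (hF (M.search F n)) with h' | h'
      · rw [h', add_zero] at h
        exact ih h
      · rw [h', lt_add_one_iff'] at h
        rcases h.lt_or_eq with h | rfl
        · exact ih h
        · exact h') n

/-- The search is computed by a closed term, which is standard, and standardness passes through
application. -/
theorem st_search {F : M.D One} {n : M.D N} (hF : M.St F) (hn : M.St n) :
    M.St (M.search F n) := by
  have := M.st_app (M.st_app (M.st_eval M.env₀
    (t := Tm.lam One (Tm.lam N (searchT (.var One 0) (.var N 0)))) (by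
      simp [searchT, addT, succT, recN, zeroN, Tm.lam, Tm.wk, Tm.ren, Ren.shift, Tm.Closed])) hF) hn
  simpa using this

/-! ### Powers of two and binary digits -/

/-- The power `2 ^ n`. -/
def pow2 : M.D N → M.D N := M.prec M.env₀ (succT zeroN) (addT (.var N 1) (.var N 1))

@[simp] theorem eval_pow2T (e : M.Env) (t : Tm N) : M.eval e (pow2T t) = M.pow2 (M.eval e t) :=
  M.prec_congr (by simp) (by simp) _

@[simp] theorem pow2_zero : M.pow2 0 = 1 := (M.prec_zero _ _ _).trans (by simp)

theorem pow2_succ (n : M.D N) : M.pow2 (n + 1) = 2 * M.pow2 n := by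
  rw [← suc_eq, two_mul]
  refine (M.prec_suc _ _ _ _).trans ?_
  simp [pow2]

theorem pow2_add (a b : M.D N) : M.pow2 (a + b) = M.pow2 a * M.pow2 b :=
  ind (P := fun b => M.pow2 (a + b) = M.pow2 a * M.pow2 b)
    (.eq (pow2T (addT (.var N 1) (.var N 0))) (mulT (pow2T (.var N 1)) (pow2T (.var N 0))))
    trivial (scons a M.env₀) (by simp) (by simp)
    (fun n h => by rw [← add_assoc, pow2_succ, h, pow2_succ]; ring) b

theorem one_le_pow2 (n : M.D N) : 1 ≤ M.pow2 n :=
  ind (P := fun n => 1 ≤ M.pow2 n) (leF (succT zeroN) (pow2T (.var N 0))) trivial M.env₀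
    (by simp) (by simp) (fun n h => by rw [pow2_succ, two_mul]; exact h.trans le_self_add) n

theorem pow2_mono {a b : M.D N} (h : a ≤ b) : M.pow2 a ≤ M.pow2 b := by
  obtain ⟨d, rfl⟩ := exists_add_of_le h
  rw [pow2_add]
  exact le_mul_of_one_le_right zero_le (M.one_le_pow2 d)

/-- The remainder modulo `2`. -/
def parity : M.D N → M.D N := M.prec M.env₀ zeroN (tsubT (succT zeroN) (.var N 1))

@[simp] theorem eval_parityT (e : M.Env) (t : Tm N) :
    M.eval e (parityT t) = M.parity (M.eval e t) :=
  M.prec_congr (by simp) (by simp) _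

@[simp] theorem parity_zero : M.parity 0 = 0 := M.prec_zero _ _ _

theorem parity_succ (n : M.D N) : M.parity (n + 1) = 1 - M.parity n := by
  rw [← suc_eq]
  refine (M.prec_suc _ _ _ _).trans ?_
  simp [parity]

theorem parity_le_one (n : M.D N) : M.parity n ≤ 1 := by
  rcases M.eq_zero_or_eq_add_one n with rfl | ⟨m, rfl⟩
  · simp
  · rw [parity_succ]; exact M.one_sub_le_one _

/-- The integer part of `n / 2`. -/
def half : M.D N → M.D N :=
  M.prec M.env₀ zeroN (addT (.var N 1) (parityT (.var N 0)))

@[simp] theorem eval_halfT (e : M.Env) (t : Tm N) : M.eval e (halfT t) = M.half (M.eval e t) :=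
  M.prec_congr (by simp) (by simp) _

@[simp] theorem half_zero : M.half 0 = 0 := M.prec_zero _ _ _

theorem half_succ (n : M.D N) : M.half (n + 1) = M.half n + M.parity n := by
  rw [← suc_eq]
  refine (M.prec_suc _ _ _ _).trans ?_
  simp [half]

theorem parity_half_two_mul (n : M.D N) : M.parity (2 * n) = 0 ∧ M.half (2 * n) = n := by
  have := ind (P := fun n => M.parity (n + n) = 0 ∧ M.half (n + n) = n)
    (.eq (parityT (addT (.var N 0) (.var N 0))) zeroN ⋏
      .eq (halfT (addT (.var N 0) (.var N 0))) (.var N 0)) (by simp) M.env₀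
    (by simp) (by simp) (fun n h => by
      have h₁ : n + 1 + (n + 1) = n + n + 1 + 1 := by ring
      rw [h₁, half_succ, half_succ, parity_succ, parity_succ, h.1, h.2]
      simp) n
  rwa [two_mul]

theorem parity_add_two_mul {a : M.D N} (ha : a ≤ 1) (n : M.D N) : M.parity (a + 2 * n) = a := by
  rcases M.le_one_iff.1 ha with rfl | rfl
  · simpa using (M.parity_half_two_mul n).1
  · rw [add_comm, parity_succ, (M.parity_half_two_mul n).1, tsub_zero]

theorem half_add_two_mul {a : M.D N} (ha : a ≤ 1) (n : M.D N) : M.half (a + 2 * n) = n := by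
  rcases M.le_one_iff.1 ha with rfl | rfl
  · simpa using (M.parity_half_two_mul n).2
  · rw [add_comm, half_succ, (M.parity_half_two_mul n).1, (M.parity_half_two_mul n).2, add_zero]

/-- The integer part of `j / 2 ^ i`. -/
def shiftRight (j : M.D N) : M.D N → M.D N :=
  M.prec (scons j M.env₀) (.var N 0) (halfT (.var N 1))

/-- The term for `shiftRight`. -/
def shiftRightT (j i : Tm N) : Tm N := recN i j (halfT (.var N 1))

@[simp] theorem eval_shiftRightT (e : M.Env) (j i : Tm N) :
    M.eval e (shiftRightT j i) = M.shiftRight (M.eval e j) (M.eval e i) :=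
  M.prec_congr (by simp) (by simp) _

@[simp] theorem shiftRight_zero (j : M.D N) : M.shiftRight j 0 = j := M.prec_zero _ _ _

theorem shiftRight_succ (j i : M.D N) : M.shiftRight j (i + 1) = M.half (M.shiftRight j i) := by
  rw [← suc_eq]
  refine (M.prec_suc _ _ _ _).trans ?_
  simp [shiftRight]

@[simp] theorem eval_bitT (e : M.Env) (i j : Tm N) :
    M.eval e (bitT i j) = M.parity (M.shiftRight (M.eval e j) (M.eval e i)) := by
  rw [bitT, eval_parityT, ← eval_shiftRightT]; rfl

/-- The number with binary digits `α 0, …, α (k - 1)`, followed by those of `l`, is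
`ofDigits α k l k`. -/
def ofDigits (α : M.D One) (k l : M.D N) : M.D N → M.D N :=
  M.prec (scons k (scons l (scons α M.env₀))) (.var N 1)
    (addT (.var One 0 ⬝ tsubT (.var N 2) (succT (.var N 0))) (addT (.var N 1) (.var N 1)))

/-- The term for `ofDigits`. -/
def ofDigitsT (α : Tm One) (k l i : Tm N) : Tm N :=
  recN i l (addT ((α.wk N).wk N ⬝ tsubT ((k.wk N).wk N) (succT (.var N 0)))
    (addT (.var N 1) (.var N 1)))

@[simp] theorem eval_ofDigitsT (e : M.Env) (α : Tm One) (k l i : Tm N) :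
    M.eval e (ofDigitsT α k l i) =
      M.ofDigits (M.eval e α) (M.eval e k) (M.eval e l) (M.eval e i) :=
  M.prec_congr (by simp) (by simp) _

@[simp] theorem ofDigits_zero (α : M.D One) (k l : M.D N) : M.ofDigits α k l 0 = l :=
  (M.prec_zero _ _ _).trans (by simp)

theorem ofDigits_succ (α : M.D One) (k l i : M.D N) :
    M.ofDigits α k l (i + 1) = M.app α (k - (i + 1)) + 2 * M.ofDigits α k l i := by
  rw [← suc_eq, two_mul]
  refine (M.prec_suc _ _ _ _).trans ?_
  simp [ofDigits]

/-- Each new low digit doubles the number and adds at most one. Hence `i` digits keep it in the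
`l`-th block of `2 ^ i` consecutive numbers. -/
theorem ofDigits_bounds (α : M.D One) (hα : ∀ n, M.app α n ≤ 1) (k l i : M.D N) :
    M.pow2 i * l ≤ M.ofDigits α k l i ∧ M.ofDigits α k l i + 1 ≤ M.pow2 i * (l + 1) :=
  ind (P := fun i => M.pow2 i * l ≤ M.ofDigits α k l i ∧
      M.ofDigits α k l i + 1 ≤ M.pow2 i * (l + 1))
    (leF (mulT (pow2T (.var N 0)) (.var N 2)) (ofDigitsT (.var One 0) (.var N 1) (.var N 2) (.var N 0))
      ⋏ leF (succT (ofDigitsT (.var One 0) (.var N 1) (.var N 2) (.var N 0)))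
        (mulT (pow2T (.var N 0)) (succT (.var N 2)))) (by simp)
    (scons k (scons l (scons α M.env₀))) (by simp) (by simp) (fun n h => by
      rw [ofDigits_succ, pow2_succ]
      constructor
      · calc 2 * M.pow2 n * l = 2 * (M.pow2 n * l) := by ring
          _ ≤ 2 * M.ofDigits α k l n := by gcongr; exact h.1
          _ ≤ _ := le_add_self
      · calc M.app α (k - (n + 1)) + 2 * M.ofDigits α k l n + 1
            ≤ 1 + 2 * M.ofDigits α k l n + 1 := by gcongr; exact hα _
          _ = 2 * (M.ofDigits α k l n + 1) := by ring
          _ ≤ 2 * (M.pow2 n * (l + 1)) := by gcongr; exact h.2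
          _ = _ := by ring) i

/-- Digits are attached from `α (k - 1)` down to `α 0`, each at the low end, and halving removes the
one attached last. -/
theorem shiftRight_ofDigits (α : M.D One) (hα : ∀ n, M.app α n ≤ 1) (k l i : M.D N) :
    i ≤ k → M.shiftRight (M.ofDigits α k l k) i = M.ofDigits α k l (k - i) :=
  ind (P := fun i => i ≤ k → M.shiftRight (M.ofDigits α k l k) i = M.ofDigits α k l (k - i))
    (leF (.var N 0) (.var N 1) ⟶ᶠ
      .eq (shiftRightT (ofDigitsT (.var One 0) (.var N 1) (.var N 2) (.var N 1)) (.var N 0))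
        (ofDigitsT (.var One 0) (.var N 1) (.var N 2) (tsubT (.var N 1) (.var N 0)))) (by simp)
    (scons k (scons l (scons α M.env₀))) (by simp) (by simp) (fun n ih h => by
      obtain ⟨d, rfl⟩ := exists_add_of_le h
      have h₁ : n + 1 + d - n = d + 1 := by
        rw [add_assoc, add_tsub_cancel_left, add_comm]
      rw [shiftRight_succ, ih (le_trans le_self_add h), h₁, add_tsub_cancel_left, ofDigits_succ,
        half_add_two_mul M (hα _)]) i

theorem parity_shiftRight_ofDigits (α : M.D One) (hα : ∀ n, M.app α n ≤ 1) (k l : M.D N)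
    {i : M.D N} (h : i < k) :
    M.parity (M.shiftRight (M.ofDigits α k l k) i) = M.app α i := by
  rw [shiftRight_ofDigits M α hα k l i h.le]
  -- With `k = i + 1 + d`, the lowest digit remaining after `i` halvings was attached at step `d +
  -- 1`, so it is `α (k - (d + 1)) = α i`.
  obtain ⟨d, rfl⟩ := exists_add_of_le (M.lt_iff_add_one_le.1 h)
  have h₁ : i + 1 + d - i = d + 1 := by
    rw [add_assoc, add_tsub_cancel_left, add_comm]
  have h₂ : i + 1 + d - (d + 1) = i := by
    rw [add_assoc, add_comm 1 d, add_tsub_cancel_right]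
  rw [h₁, ofDigits_succ, parity_add_two_mul M (hα _), h₂]

end EModel
namespace EModel
variable (M : EModel)

/-! ### Semantics of the principles -/

/-- Binary functions. -/
def Binary (α : M.D One) : Prop := ∀ n, M.app α n ≤ 1

/-- Binary trees. -/
def BinTree (T : M.D TreeTy) : Prop :=
  ∀ w, M.app T w ≤ 1 ∧ (M.app T w = 1 → (∀ i < M.len w, M.app (M.entries w) i ≤ 1) ∧
    ∀ m ≤ M.len w, M.app T (M.mkSeq m (M.entries w)) = 1)

/-- The binary word of length `n` whose entries are the binary digits of `j`. -/
def word (n j : M.D N) : M.D (.seq N) :=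
  M.eval (scons n (scons j M.env₀)) (wordT (.var N 0) (.var N 1))

/-- The number of elements of length `n` of a binary tree. -/
def count (T : M.D TreeTy) (n : M.D N) : M.D N :=
  M.eval (scons n (scons T M.env₀)) (countT (.var TreeTy 0) (.var N 0))

/-- Trees of positive measure. -/
def PosMeasure (T : M.D TreeTy) : Prop := ∃ k, ∀ n, M.pow2 n ≤ k * M.count T n

/-- Trees with a standard path, up to standard length. -/
def HasStandardPath (T : M.D TreeTy) : Prop :=
  ∃ β : M.D One, M.St β ∧ M.Binary β ∧ ∀ m, M.St m → M.app T (M.mkSeq m β) = 1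

/-- Every binary function is infinitely close to a standard one. -/
def STP : Prop :=
  ∀ α, M.Binary α → ∃ β, M.St β ∧ M.Binary β ∧ ∀ n, M.St n → M.app α n = M.app β n

/-- Every binary tree of positive measure has a standard path, up to standard length. -/
def LMPplus : Prop := ∀ T, M.BinTree T → M.PosMeasure T → M.HasStandardPath T

/-- Every infinite binary tree has a standard path, up to standard length. -/
def STPminus : Prop :=
  ∀ T, M.BinTree T → (∀ n, ∃ w, M.app T w = 1 ∧ M.len w = n) → M.HasStandardPath T

/-- Every binary tree of positive measure has a path. -/
def WWKL : Prop :=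
  ∀ T, M.BinTree T → M.PosMeasure T → ∃ β, M.Binary β ∧ ∀ m, M.app T (M.mkSeq m β) = 1

@[simp] theorem sat_binary (e : M.Env) (f : Tm One) :
    M.Sat e (binary f) ↔ M.Binary (M.eval e f) := by
  simp [binary, Binary]

@[simp] theorem sat_memTree (e : M.Env) (s : Tm (.seq N)) (T : Tm TreeTy) :
    M.Sat e (memTree s T) ↔ M.app (M.eval e T) (M.eval e s) = 1 := by
  simp [memTree]

@[simp] theorem sat_binTree (e : M.Env) (T : Tm TreeTy) :
    M.Sat e (binTree T) ↔ M.BinTree (M.eval e T) := by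
  simp [binTree, BinTree]

@[simp] theorem eval_wordT (e : M.Env) (n j : Tm N) :
    M.eval e (wordT n j) = M.word (M.eval e n) (M.eval e j) := by
  simp only [word, wordT, eval_mkT, Str.eval_var, scons_zero]
  congr 1
  exact app_ext fun i => by simp

@[simp] theorem len_word (n j : M.D N) : M.len (M.word n j) = n := by
  simp [word, wordT]

theorem entries_word {n i : M.D N} (j : M.D N) (h : i < n) :
    M.app (M.entries (M.word n j)) i = M.parity (M.shiftRight j i) := by
  simp [word, wordT, entries_mkSeq M _ h]

theorem count_eq (T : M.D TreeTy) (n : M.D N) :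
    M.count T n = M.sum (M.eval (scons n (scons T M.env₀))
      (Tm.lam N (.var TreeTy 0 ⬝ wordT (.var N 1) (.var N 0)))) (M.pow2 n) := by
  simp only [count, countT, sum, eval_recN, eval_pow2T, Str.eval_var, scons_zero]
  exact M.prec_congr (by simp) (by simp) _

@[simp] theorem eval_countT (e : M.Env) (T : Tm TreeTy) (n : Tm N) :
    M.eval e (countT T n) = M.count (M.eval e T) (M.eval e n) := by
  simp only [count, countT, eval_recN, eval_pow2T, Str.eval_var, scons_zero]
  exact M.prec_congr (by simp) (by simp) _

@[simp] theorem sat_posMeasure (e : M.Env) (T : Tm TreeTy) :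
    M.Sat e (posMeasure T) ↔ M.PosMeasure (M.eval e T) := by
  simp [posMeasure, PosMeasure]

@[simp] theorem sat_hasStandardPath (e : M.Env) (T : Tm TreeTy) :
    M.Sat e (hasStandardPath T) ↔ M.HasStandardPath (M.eval e T) := by
  simp [hasStandardPath, HasStandardPath]

theorem sat_STP (e : M.Env) : M.Sat e NSA.STP ↔ M.STP := by
  simp [NSA.STP, STP]

theorem sat_LMPplus (e : M.Env) : M.Sat e NSA.LMPplus ↔ M.LMPplus := by
  simp [NSA.LMPplus, LMPplus]

theorem sat_STPminus (e : M.Env) : M.Sat e NSA.STPminus ↔ M.STPminus := by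
  simp [NSA.STPminus, STPminus, infiniteTree]

theorem sat_WWKL (e : M.Env) : M.Sat e NSA.WWKL ↔ M.WWKL := by
  simp [NSA.WWKL, WWKL]

/-! ### Idealisation and initial segments of the standard numbers -/

/-- There is a number above all standard numbers. -/
theorem exists_infinite : ∃ K : M.D N, ∀ n : M.D N, M.St n → n ≤ K := by
  have h := M.models _ (.ideal N N (leF (.var N 0) (.var N 1)) trivial) M.env₀
  simp only [Idealisation, Str.sat_imp, Str.sat_allSt, Str.sat_ex, sat_allMem, Str.sat_ren,
    scons_up, sat_leF, Str.eval_var, Str.eval_wk, scons_zero, scons_one] at h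
  -- Idealisation asks for a bound on the entries of one finite sequence at a time; the sum of the
  -- entries is such a bound.
  exact h fun s _ => ⟨M.sum (M.entries s) (M.len s), fun i hi => M.le_sum _ hi⟩

/-- Numbers below a standard number are standard. -/
theorem STP.st_of_lt {M : EModel} (h : M.STP) {i m : M.D N} (hi : i < m) (hm : M.St m) :
    M.St i := by
  -- `α` is the characteristic function of `{n | n < i}`. Its standard approximation `β` and the
  -- standard bound `m` yield a standard search result, which turns out to be `i`.
  let α := M.eval (scons i M.env₀)
    (Tm.lam N (tsubT (succT zeroN) (tsubT (succT (.var N 0)) (.var N 1))))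
  have hα : ∀ n, M.app α n = 1 - (n + 1 - i) := fun n => by simp [α]
  obtain ⟨β, hβ, hbin, hαβ⟩ := h α fun n => by rw [hα]; exact M.one_sub_le_one _
  have hlt : ∀ n, M.St n → (M.app β n = 1 ↔ n < i) := fun n hn => by
    rw [← hαβ n hn, hα, one_sub_eq_one_iff, lt_iff_add_one_le, le_def']
  have hst := M.st_search hβ hm
  -- If the search runs up to `m` without stopping, `β` still vanishes there, since `m` is standard
  -- and not below `i`.
  have hz : M.app β (M.search β m) = 0 := by
    by_cases hs : M.search β m = m
    · rw [hs]
      refine (M.le_one_iff.1 (hbin m)).resolve_right fun h' => ?_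
      exact absurd ((hlt m hm).1 h') hi.not_gt
    · exact M.search_spec β hbin m hs
  have hle : i ≤ M.search β m := by
    refine not_lt.1 fun h' => ?_
    rw [(hlt _ hst).2 h'] at hz
    exact one_ne_zero hz
  rcases M.eq_zero_or_eq_add_one (M.search β m) with hs | ⟨p, hp⟩
  · rw [hs, nonpos_iff_eq_zero] at hle
    rw [hle]
    exact M.st_zero
  · have hpst : M.St p := by
      have := M.st_pred hst
      rwa [hp, pred_add_one] at this
    -- The predecessor `p` of the search result is standard and was passed by the search, so `β p =
    -- 1` and hence `p < i`. The result is therefore at most `i`.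
    have hpi : p < i := (hlt p hpst).1
      (M.eq_one_of_lt_search β hbin (by rw [hp]; exact M.lt_add_one_iff'.2 le_rfl))
    rw [le_antisymm hle (by rw [hp]; exact M.lt_iff_add_one_le.1 hpi)]
    exact hst

/-! ### From standard parts to standard paths -/

theorem STP.mkSeq_eq {M : EModel} (h : M.STP) {α β : M.D One}
    (hαβ : ∀ n, M.St n → M.app α n = M.app β n) {m : M.D N} (hm : M.St m) :
    M.mkSeq m α = M.mkSeq m β :=
  M.mkSeq_congr fun _ hi => hαβ _ (h.st_of_lt hi hm)

theorem STP.lmpPlus {M : EModel} (h : M.STP) (hW : M.WWKL) : M.LMPplus := by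
  intro T hT hpos
  obtain ⟨α, hα, hTα⟩ := hW T hT hpos
  obtain ⟨β, hβ, hbin, hαβ⟩ := h α hα
  exact ⟨β, hβ, hbin, fun m hm => by rw [← h.mkSeq_eq hαβ hm]; exact hTα m⟩

theorem STP.stpMinus {M : EModel} (h : M.STP) : M.STPminus := by
  intro T hT hinf
  obtain ⟨K, hK⟩ := M.exists_infinite
  obtain ⟨w, hw, hlen⟩ := hinf K
  obtain ⟨hbin, hclosed⟩ := (hT w).2 hw
  -- Entries beyond the length of `w` are zero, so the entries of the single word `w` form a total
  -- binary sequence.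
  obtain ⟨β, hβ, hβbin, hαβ⟩ := h (M.entries w) fun n => by
    rcases lt_or_ge n (M.len w) with hn | hn
    · exact hbin n hn
    · rw [entries_of_le M w hn]; exact zero_le
  refine ⟨β, hβ, hβbin, fun m hm => ?_⟩
  rw [← h.mkSeq_eq hαβ hm]
  exact hclosed m (by rw [hlen]; exact hK m hm)

/-! ### The tree of binary words that agree with `α` below `k` -/

/-- The term for a function of `w` and `i` (`var N 0`) that vanishes if and only if `w_i ≤ 1` and,
in case `i < k` (`var N 1`), `w_i = α i`. -/
def agreeT : Tm N :=
  addT (tsubT (projT (.var (.seq N) 0) (.var N 0)) (succT zeroN))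
    -- The factor `1 - ((i + 1) - k)` is `1` for `i < k` and `0` otherwise; the two truncated
    -- differences add up to the distance between `w_i` and `α i`.
    (mulT (tsubT (succT zeroN) (tsubT (succT (.var N 0)) (.var N 1)))
      (addT (tsubT (projT (.var (.seq N) 0) (.var N 0)) (.var One 0 ⬝ .var N 0))
        (tsubT (.var One 0 ⬝ .var N 0) (projT (.var (.seq N) 0) (.var N 0)))))

/-- The tree of binary words that agree with `α` below `k`. -/
def agreeTree (α : M.D One) (k : M.D N) : M.D TreeTy :=
  M.eval (scons α (scons k M.env₀))
    (Tm.lam (.seq N) (allZeroT (Tm.lam N agreeT) (lenT (.var (.seq N) 0))))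

theorem agreeTree_le_one (α : M.D One) (k : M.D N) (w : M.D (.seq N)) :
    M.app (M.agreeTree α k) w ≤ 1 := by
  simp [agreeTree, allZero_le_one]

theorem mem_agreeTree (α : M.D One) (k : M.D N) (w : M.D (.seq N)) :
    M.app (M.agreeTree α k) w = 1 ↔ ∀ i < M.len w,
      M.app (M.entries w) i ≤ 1 ∧ (i < k → M.app (M.entries w) i = M.app α i) := by
  simp only [agreeTree, app_lam, eval_allZeroT, eval_lenT, Str.eval_var, scons_zero,
    allZero_eq_one_iff]
  refine forall₂_congr fun i _ => ?_
  have h₀ : ∀ a b : M.D N, a + b = 0 ↔ a = 0 ∧ b = 0 := fun a b => add_eq_zero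
  have h₁ : ∀ a b : M.D N, a - b = 0 ↔ a ≤ b := fun a b => Iff.rfl
  by_cases hi : i < k
  · have h₃ : i + 1 - k = 0 := M.lt_iff_add_one_le.1 hi
    simp [agreeT, h₀, h₃, hi, h₁, ← le_antisymm_iff]
  · have h₃ : (1 : M.D N) - (i + 1 - k) = 0 := by
      obtain ⟨d, rfl⟩ := exists_add_of_le (not_lt.1 hi)
      rw [add_assoc, add_tsub_cancel_left]
      exact tsub_eq_zero_of_le le_add_self
    simp [agreeT, h₃, hi, h₁]

theorem binTree_agreeTree (α : M.D One) (k : M.D N) : M.BinTree (M.agreeTree α k) := by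
  refine fun w => ⟨M.agreeTree_le_one α k w, fun hw => ?_⟩
  rw [mem_agreeTree] at hw
  refine ⟨fun i hi => (hw i hi).1, fun m hm => ?_⟩
  rw [mem_agreeTree]
  intro i hi
  rw [len_mkSeq] at hi
  rw [entries_mkSeq M _ hi]
  exact hw i (hi.trans_le hm)

theorem infinite_agreeTree {α : M.D One} (hα : M.Binary α) (k n : M.D N) :
    ∃ w, M.app (M.agreeTree α k) w = 1 ∧ M.len w = n := by
  refine ⟨M.mkSeq n α, ?_, by simp⟩
  rw [mem_agreeTree]
  intro i hi
  rw [len_mkSeq] at hi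
  rw [entries_mkSeq M _ hi]
  exact ⟨hα i, fun _ => rfl⟩

/-- Words of length `n = k' + d` are indexed by `j < 2 ^ k' * 2 ^ d`. Each block of `2 ^ k'`
consecutive indices contains one whose low digits are `α 0, …, α (k' - 1)`, namely `ofDigits α k' l
k'` in block `l`. Its word lies in the tree, so there are at least `2 ^ d` elements. The separate
`k'` covers lengths below `k`, where only `n` digits are constrained. -/
theorem le_count_agreeTree {α : M.D One} (hα : M.Binary α) {k k' n : M.D N} (hn : k' ≤ n)
    (hk : ∀ i < n, i < k → i < k') : M.pow2 n ≤ M.pow2 k' * M.count (M.agreeTree α k) n := by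
  obtain ⟨d, rfl⟩ := exists_add_of_le hn
  rw [pow2_add]
  gcongr
  rw [count_eq, pow2_add]
  refine M.le_sum_mul _ _ (fun l => ⟨M.ofDigits α k' l k', ?_, ?_, ?_⟩) _
  · exact (M.ofDigits_bounds α hα k' l k').1
  · rw [lt_iff_add_one_le]
    exact (M.ofDigits_bounds α hα k' l k').2
  · simp only [app_lam, Str.eval_app, Str.eval_var, eval_wordT, scons_zero, scons_one]
    rw [scons_of_ne _ _ (by simp), scons_of_ne _ _ (by simp), scons_zero, mem_agreeTree]
    intro i hi
    rw [len_word] at hi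
    rw [entries_word M _ hi]
    refine ⟨M.parity_le_one _, fun hik => ?_⟩
    exact M.parity_shiftRight_ofDigits α hα k' l (hk i hi hik)

/-- The bound `2 ^ k` works for all lengths, and nothing requires it to be standard. This is what
lets `k` be taken above all standard numbers. -/
theorem posMeasure_agreeTree {α : M.D One} (hα : M.Binary α) (k : M.D N) :
    M.PosMeasure (M.agreeTree α k) := by
  refine ⟨M.pow2 k, fun n => ?_⟩
  rcases le_total k n with h | h
  · exact M.le_count_agreeTree hα h fun i _ hi => hi
  -- For `n ≤ k` all `n` digits are prescribed: the count is taken with `k' = n`, and `2 ^ n` is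
  -- then enlarged to `2 ^ k`.
  · refine (M.le_count_agreeTree hα (k := k) le_rfl fun i hi _ => hi).trans ?_
    gcongr
    exact M.pow2_mono h

/-! ### From standard paths back to standard parts -/

theorem HasStandardPath.exists_eq {M : EModel} {α : M.D One} {K : M.D N}
    (hK : ∀ n : M.D N, M.St n → n ≤ K) (h : M.HasStandardPath (M.agreeTree α K)) :
    ∃ β, M.St β ∧ M.Binary β ∧ ∀ n, M.St n → M.app α n = M.app β n := by
  obtain ⟨β, hβ, hbin, hpath⟩ := h
  refine ⟨β, hβ, hbin, fun n hn => ?_⟩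
  -- The entry at `n` is read off the initial segment of length `n + 1`, which is again standard; it
  -- therefore lies in the tree, and `n + 1 ≤ K` puts `n` in the range of agreement.
  have hn' := M.st_add_one hn
  have hlt : n < n + 1 := M.lt_add_one_iff'.2 le_rfl
  have h₁ := ((M.mem_agreeTree α K _).1 (hpath _ hn') n (by rwa [len_mkSeq])).2
    (M.lt_iff_add_one_le.2 (hK _ hn'))
  rw [entries_mkSeq M _ hlt] at h₁
  exact h₁.symm

theorem LMPplus.stp {M : EModel} (h : M.LMPplus) : M.STP := fun α hα =>
  have ⟨K, hK⟩ := M.exists_infinite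
  (h _ (M.binTree_agreeTree α K) (M.posMeasure_agreeTree hα K)).exists_eq hK

theorem STPminus.stp {M : EModel} (h : M.STPminus) : M.STP := fun α hα =>
  have ⟨K, hK⟩ := M.exists_infinite
  (h _ (M.binTree_agreeTree α K) (M.infinite_agreeTree hα K)).exists_eq hK

theorem stp_iff_lmpPlus (hW : M.WWKL) : M.STP ↔ M.LMPplus := ⟨fun h => h.lmpPlus hW, LMPplus.stp⟩

theorem stp_iff_stpMinus : M.STP ↔ M.STPminus := ⟨STP.stpMinus, STPminus.stp⟩

end EModel
end NSA

/-! ### The equivalences as provability statements -/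

theorem theorem4p7 :
    NSA.Provable ({φ | NSA.Pzero φ} ∪ {NSA.WWKL}) (NSA.Fm.iff NSA.STP NSA.LMPplus) ∧
    NSA.Provable ({φ | NSA.Pzero φ} ∪ {NSA.WWKL}) (NSA.Fm.iff NSA.LMPplus NSA.STPminus) ∧
    NSA.Provable ({φ | NSA.Pzero φ} ∪ {NSA.WWKL}) (NSA.Fm.iff NSA.STP NSA.STPminus) := by
  have hW : ∀ M : NSA.EModel, M.Models ({φ | NSA.Pzero φ} ∪ {NSA.WWKL}) → M.WWKL := fun M hM =>
    (M.sat_WWKL M.env₀).1 (hM _ (.inr rfl) _)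
  refine ⟨?_, ?_, ?_⟩ <;>
    refine NSA.provable_of_emodels Set.subset_union_left fun M hM e => ?_ <;>
    simp only [NSA.Str.sat_iff, NSA.EModel.sat_STP, NSA.EModel.sat_LMPplus,
      NSA.EModel.sat_STPminus]
  · exact M.stp_iff_lmpPlus (hW M hM)
  · exact (M.stp_iff_lmpPlus (hW M hM)).symm.trans M.stp_iff_stpMinus
  · exact M.stp_iff_stpMinus
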